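/- Fix an integer $c \ge 2$. The problem $\mathrm{succETR}^{1/8}_{[-1/8,1/8]}$: an instance consists of seven Boolean circuits $C_0,\dots,C_6:\{0,1\}^M\to\{0,1\}^N$ over the basis $\{\neg,\wedge,\vee\}$ (input nodes are counted in the size). It is a yes-instance if there are real numbers $x_e\in[-\tfrac18,\tfrac18]$, $e\in\{0,1\}^N$, such that for every $j\in\{0,1\}^M$ $$x_{C_0(j)}=\tfrac18,\qquad x_{C_1(j)}+x_{C_2(j)}=x_{C_3(j)},\qquad x_{C_4(j)}\cdot x_{C_5(j)}=x_{C_6(j)}.$$ The problem $\mathrm{Sat}_{prob}$: events are given by the grammar $\delta ::= X=x \mid \neg\delta\mid\delta\wedge\delta$, where $X$ is one of the random variables $X_0,X_1,\dots$ with values in $\{0,\dots,c-1\}$ and $x$ is either such a value or a summation variable; terms by $\mathbf e::=\mathbb P(\delta)\mid\mathbb P(\delta\mid\delta')\mid\mathbf e+\mathbf e\mid\mathbf e\cdot\mathbf e\mid\sum_x\mathbf e$, where the summation variable $x$ ranges over $0,\dots,c-1$; formulas by $\varphi::=\mathbf e\le\mathbf e\mid\neg\varphi\mid\varphi\wedge\varphi$,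 where every summation variable has to be bound by a sum. Terms and formulas are interpreted in recursive structural causal models (finitely many endogenous variables $X_0,\dots,X_{n-1}$ that include those of the formula, each computed by a measurable function from its predecessors and from exogenous variables with an arbitrary joint probability distribution), with $\mathbb P(\delta\mid\delta')=\mathbb P(\delta\wedge\delta')/\mathbb P(\delta')$, read as $0$ if $\mathbb P(\delta')=0$. A formula $\varphi$ is a yes-instance if some such model satisfies it. Then $\mathrm{succETR}^{1/8}_{[-1/8,1/8]}\le_p \mathrm{Sat}_{prob}$, that is, there is a polynomial-time many-one reduction from the first problem to the second. -/

import Mathlib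

/-! ## Polynomial-time many-one reductions -/

/-- `A ≤ₚ B` for decision problems `A` and `B` whose instances are written as strings over finite
alphabets: some `f`, computed by a Turing machine in time polynomial in the length of the encoded
instance, maps yes-instances to yes-instances and no-instances to no-instances. -/
def PolyTimeReducible {α β Γ Δ : Type} [Fintype Γ] [Fintype Δ]
    (ea : Computability.Encoding α Γ) (eb : Computability.Encoding β Δ)
    (A : Set α) (B : Set β) : Prop :=
  ∃ f : α → β, Nonempty (Turing.TM2ComputableInPolyTime ea.encode eb.encode f) ∧
    ∀ a, a ∈ A ↔ f a ∈ B

open Classical in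
/-- An injective map into strings is an encoding in Mathlib's sense. -/
noncomputable def encodingOfInjective {α Γ : Type} (enc : α → List Γ)
    (h : Function.Injective enc) : Computability.Encoding α Γ where
  encode := enc
  decode s := if hs : ∃ a, enc a = s then some hs.choose else none
  decode_encode a := by
    have hs : ∃ a', enc a' = enc a := ⟨a, rfl⟩
    rw [dif_pos hs]
    exact congrArg some (h hs.choose_spec)

/-- A number, written as `n` strokes followed by a separator. -/
def strokes {Γ : Type} (one sep : Γ) (n : ℕ) : List Γ :=
  List.replicate n one ++ [sep]

theorem strokes_append_inj {Γ : Type} {one sep : Γ} (hne : one ≠ sep) :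
    ∀ {m n : ℕ} {s t : List Γ},
      strokes one sep m ++ s = strokes one sep n ++ t → m = n ∧ s = t
  | 0, 0, s, t, h => by simpa [strokes] using h
  | 0, n + 1, s, t, h => by
      simp [strokes, List.replicate_succ] at h
      exact absurd h.1.symm hne
  | m + 1, 0, s, t, h => by
      simp [strokes, List.replicate_succ] at h
      exact absurd h.1 hne
  | m + 1, n + 1, s, t, h => by
      have h' : strokes one sep m ++ s = strokes one sep n ++ t := by
        simpa [strokes, List.replicate_succ] using h
      obtain ⟨h1, h2⟩ := strokes_append_inj hne h'
      exact ⟨by rw [h1], h2⟩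

/-! ## Boolean circuits -/

/-- An inner node of a circuit, with its children among the first `n` nodes. -/
inductive Gate (n : ℕ) : Type
  | neg (u : Fin n)
  | conj (u w : Fin n)
  | disj (u w : Fin n)

/-- The inner nodes of a circuit in topological order: `GateList n m` extends `n` given nodes to
`m` nodes, every gate reading only nodes that precede it. Fan-out is unbounded. -/
inductive GateList : ℕ → ℕ → Type
  | nil (n : ℕ) : GateList n n
  | cons {n m : ℕ} (g : Gate n) (rest : GateList (n + 1) m) : GateList n m

/-- A Boolean circuit with `M` input nodes (the nodes `0, …, M - 1`) and `N` output nodes. -/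
structure Circuit (M N : ℕ) : Type where
  nodes : ℕ
  gates : GateList M nodes
  out : Fin N → Fin nodes

def Gate.eval {n : ℕ} (v : Fin n → Bool) : Gate n → Bool
  | .neg u => !(v u)
  | .conj u w => v u && v w
  | .disj u w => v u || v w

/-- The values of all nodes, from the values of the first `n`. -/
def GateList.eval : {n m : ℕ} → GateList n m → (Fin n → Bool) → (Fin m → Bool)
  | _, _, .nil _, v => v
  | _, _, .cons g rest, v => rest.eval (Fin.snoc (α := fun _ => Bool) v (g.eval v))

/-- The function `{0,1}^M → {0,1}^N` that the circuit computes. -/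
def Circuit.eval {M N : ℕ} (C : Circuit M N) (j : Fin M → Bool) : Fin N → Bool :=
  fun k => C.gates.eval j (C.out k)

/-! ## The succinct problem `ETR^c_[a,b]` -/

/-- An instance: seven circuits `C₀, …, C₆ : {0,1}^M → {0,1}^N`. -/
structure SuccInstance : Type where
  M : ℕ
  N : ℕ
  C : Fin 7 → Circuit M N

/-- The yes-instances. The real variables are `x_e` with `e ∈ {0,1}^N`, and each `j ∈ {0,1}^M`
gives one equation of each of the three types. -/
def SuccETR (c a b : ℝ) : Set SuccInstance :=
  {I | ∃ x : (Fin I.N → Bool) → ℝ, (∀ e, x e ∈ Set.Icc a b) ∧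
    ∀ j : Fin I.M → Bool,
      x ((I.C 0).eval j) = c ∧
      x ((I.C 1).eval j) + x ((I.C 2).eval j) = x ((I.C 3).eval j) ∧
      x ((I.C 4).eval j) * x ((I.C 5).eval j) = x ((I.C 6).eval j)}

/-- The alphabet in which instances are written. -/
inductive CSym : Type
  | one | sep | neg | conj | disj | out | done
  deriving DecidableEq

instance : Fintype CSym where
  elems := {.one, .sep, .neg, .conj, .disj, .out, .done}
  complete s := by cases s <;> simp

/-- Node numbers are written in unary. They are smaller than the number of nodes, so that the
length of the string is polynomially related to the number of nodes. -/
def CSym.num (n : ℕ) : List CSym := strokes CSym.one CSym.sep n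

def Gate.encode {n : ℕ} : Gate n → List CSym
  | .neg u => CSym.neg :: CSym.num u
  | .conj u w => CSym.conj :: (CSym.num u ++ CSym.num w)
  | .disj u w => CSym.disj :: (CSym.num u ++ CSym.num w)

def GateList.encode : {n m : ℕ} → GateList n m → List CSym
  | _, _, .nil _ => [CSym.out]
  | _, _, .cons g rest => g.encode ++ rest.encode

/-- All gates in order, then the numbers of the output nodes. -/
def Circuit.encode {M N : ℕ} (C : Circuit M N) : List CSym :=
  C.gates.encode ++
    ((List.ofFn fun k => CSym.num (C.out k)).flatten ++ [CSym.done])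

/-- `M` and `N` in unary, then the seven circuits. -/
def SuccInstance.encode (I : SuccInstance) : List CSym :=
  CSym.num I.M ++ (CSym.num I.N ++ (List.ofFn fun i => (I.C i).encode).flatten)

theorem CSym.num_append_inj {m n : ℕ} {s t : List CSym}
    (h : CSym.num m ++ s = CSym.num n ++ t) : m = n ∧ s = t :=
  strokes_append_inj (by decide) h

theorem Gate.encode_append_inj {n : ℕ} {g g' : Gate n} {s t : List CSym}
    (h : g.encode ++ s = g'.encode ++ t) : g = g' ∧ s = t := by
  cases g <;> cases g' <;>
    simp only [Gate.encode, List.cons_append, List.append_assoc, List.cons.injEq, reduceCtorEq,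
      true_and, false_and] at h
  · obtain ⟨h1, h2⟩ := CSym.num_append_inj h
    exact ⟨by rw [Fin.ext h1], h2⟩
  · obtain ⟨h1, h2⟩ := CSym.num_append_inj h
    obtain ⟨h3, h4⟩ := CSym.num_append_inj h2
    exact ⟨by rw [Fin.ext h1, Fin.ext h3], h4⟩
  · obtain ⟨h1, h2⟩ := CSym.num_append_inj h
    obtain ⟨h3, h4⟩ := CSym.num_append_inj h2
    exact ⟨by rw [Fin.ext h1, Fin.ext h3], h4⟩

theorem GateList.encode_append_inj {n m : ℕ} (G : GateList n m) :
    ∀ {m' : ℕ} (G' : GateList n m') {s t : List CSym},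
      G.encode ++ s = G'.encode ++ t → m = m' ∧ HEq G G' ∧ s = t := by
  induction G with
  | nil n =>
    intro m' G' s t h
    cases G' with
    | nil => simpa [GateList.encode] using h
    | cons g rest => cases g <;> simp [GateList.encode, Gate.encode] at h
  | cons g rest ih =>
    intro m' G' s t h
    cases G' with
    | nil => cases g <;> simp [GateList.encode, Gate.encode] at h
    | cons g' rest' =>
      simp only [GateList.encode, List.append_assoc] at h
      obtain ⟨rfl, h1⟩ := Gate.encode_append_inj h
      obtain ⟨rfl, h2, h3⟩ := ih rest' h1
      obtain rfl := eq_of_heq h2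
      exact ⟨rfl, HEq.rfl, h3⟩

theorem flatten_ofFn_append_inj {α Γ : Type} (enc : α → List Γ)
    (henc : ∀ {x y : α} {s t : List Γ}, enc x ++ s = enc y ++ t → x = y ∧ s = t) :
    ∀ {k : ℕ} {f g : Fin k → α} {s t : List Γ},
      (List.ofFn fun i => enc (f i)).flatten ++ s =
        (List.ofFn fun i => enc (g i)).flatten ++ t → f = g ∧ s = t := by
  intro k
  induction k with
  | zero =>
    intro f g s t h
    exact ⟨Subsingleton.elim _ _, by simpa using h⟩
  | succ k ih =>
    intro f g s t h
    simp only [List.ofFn_succ, List.flatten_cons, List.append_assoc] at h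
    obtain ⟨h0, h1⟩ := henc h
    obtain ⟨h2, h3⟩ := ih (f := fun i => f i.succ) (g := fun i => g i.succ) h1
    refine ⟨funext fun i => ?_, h3⟩
    refine Fin.cases h0 (fun i => ?_) i
    exact congrFun h2 i

theorem Circuit.encode_append_inj {M N : ℕ} {C C' : Circuit M N} {s t : List CSym}
    (h : C.encode ++ s = C'.encode ++ t) : C = C' ∧ s = t := by
  obtain ⟨m, G, o⟩ := C
  obtain ⟨m', G', o'⟩ := C'
  simp only [Circuit.encode, List.append_assoc] at h
  obtain ⟨rfl, h1, h2⟩ := GateList.encode_append_inj G G' h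
  obtain rfl := eq_of_heq h1
  obtain ⟨h3, h4⟩ := flatten_ofFn_append_inj (fun u : Fin m => CSym.num u)
    (fun h => ⟨Fin.ext (CSym.num_append_inj h).1, (CSym.num_append_inj h).2⟩) h2
  subst h3
  exact ⟨rfl, by simpa using h4⟩

theorem SuccInstance.encode_injective : Function.Injective SuccInstance.encode := by
  rintro ⟨M, N, C⟩ ⟨M', N', C'⟩ h
  simp only [SuccInstance.encode] at h
  obtain ⟨rfl, h1⟩ := CSym.num_append_inj h
  obtain ⟨rfl, h2⟩ := CSym.num_append_inj h1
  obtain ⟨rfl, -⟩ := flatten_ofFn_append_inj (fun D : Circuit M N => D.encode)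
    Circuit.encode_append_inj (congrArg (· ++ []) h2)
  rfl

noncomputable def SuccInstance.encoding : Computability.Encoding SuccInstance CSym :=
  encodingOfInjective SuccInstance.encode SuccInstance.encode_injective

/-! ## The probabilistic language over the values `0, …, c - 1` -/

/-- The right-hand side of `X = x`: a value, or a summation variable (named by a number). -/
inductive ValTerm (c : ℕ) : Type
  | const (v : Fin c)
  | dummy (y : ℕ)

/-- Events: Boolean conditions on the values of the random variables `X₀, X₁, …`. -/
inductive PropFormula (c : ℕ) : Type
  | eq (X : ℕ) (x : ValTerm c)
  | neg (δ : PropFormula c)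
  | conj (δ δ' : PropFormula c)

/-- Arithmetic terms: `P(δ)`, `P(δ | δ')`, sums, products and `∑_y e`. -/
inductive ProbTerm (c : ℕ) : Type
  | prob (δ : PropFormula c)
  | cond (δ δ' : PropFormula c)
  | add (e e' : ProbTerm c)
  | mul (e e' : ProbTerm c)
  | sum (y : ℕ) (e : ProbTerm c)

/-- Boolean combinations of inequalities between terms. -/
inductive ProbFormula (c : ℕ) : Type
  | le (e e' : ProbTerm c)
  | neg (φ : ProbFormula c)
  | conj (φ φ' : ProbFormula c)

/-! ### Summation variables are bound, random variables belong to the model -/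

def ValTerm.BoundIn {c : ℕ} (B : Set ℕ) : ValTerm c → Prop
  | .const _ => True
  | .dummy y => y ∈ B

/-- All summation variables of `δ` lie in `B`. -/
def PropFormula.BoundIn {c : ℕ} (B : Set ℕ) : PropFormula c → Prop
  | .eq _ x => x.BoundIn B
  | .neg δ => δ.BoundIn B
  | .conj δ δ' => δ.BoundIn B ∧ δ'.BoundIn B

/-- All free summation variables of `e` lie in `B`. -/
def ProbTerm.BoundIn {c : ℕ} : Set ℕ → ProbTerm c → Prop
  | B, .prob δ => δ.BoundIn B
  | B, .cond δ δ' => δ.BoundIn B ∧ δ'.BoundIn B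
  | B, .add e e' => e.BoundIn B ∧ e'.BoundIn B
  | B, .mul e e' => e.BoundIn B ∧ e'.BoundIn B
  | B, .sum y e => e.BoundIn (insert y B)

/-- Every summation variable occurs in the scope of a summation over it. -/
def ProbFormula.Closed {c : ℕ} : ProbFormula c → Prop
  | .le e e' => e.BoundIn ∅ ∧ e'.BoundIn ∅
  | .neg φ => φ.Closed
  | .conj φ φ' => φ.Closed ∧ φ'.Closed

/-- All random variables of `δ` are among `X₀, …, X_{n-1}`. -/
def PropFormula.VarsBelow {c : ℕ} (n : ℕ) : PropFormula c → Prop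
  | .eq X _ => X < n
  | .neg δ => δ.VarsBelow n
  | .conj δ δ' => δ.VarsBelow n ∧ δ'.VarsBelow n

def ProbTerm.VarsBelow {c : ℕ} (n : ℕ) : ProbTerm c → Prop
  | .prob δ => δ.VarsBelow n
  | .cond δ δ' => δ.VarsBelow n ∧ δ'.VarsBelow n
  | .add e e' => e.VarsBelow n ∧ e'.VarsBelow n
  | .mul e e' => e.VarsBelow n ∧ e'.VarsBelow n
  | .sum _ e => e.VarsBelow n

def ProbFormula.VarsBelow {c : ℕ} (n : ℕ) : ProbFormula c → Prop
  | .le e e' => e.VarsBelow n ∧ e'.VarsBelow n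
  | .neg φ => φ.VarsBelow n
  | .conj φ φ' => φ.VarsBelow n ∧ φ'.VarsBelow n

/-! ## Structural causal models -/

/-- A recursive structural causal model with endogenous variables `X₀, …, X_{n-1}` that take
values in `{0, …, c - 1}`. The exogenous variables are indexed by `Exo` and have the joint
distribution `P`; the function `F i` computes `X_i` from the preceding endogenous variables and
the exogenous ones. -/
structure SCM (n c : ℕ) : Type 1 where
  Exo : Type
  Dom : Exo → Type
  measurableSpace : ∀ k, MeasurableSpace (Dom k)
  P : MeasureTheory.Measure (∀ k, Dom k)
  isProbabilityMeasure : MeasureTheory.IsProbabilityMeasure P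
  F : (i : Fin n) → (Fin i → Fin c) → (∀ k, Dom k) → Fin c
  measurable_F : ∀ i x, Measurable (F i x)

/-- The values of the endogenous variables, calculated from the values `u` of the exogenous
ones. -/
def SCM.value {n c : ℕ} (𝔐 : SCM n c) (u : ∀ k, 𝔐.Dom k) (i : Fin n) : Fin c :=
  𝔐.F i (fun j => 𝔐.value u ⟨j, j.isLt.trans i.isLt⟩) u
termination_by i.val
decreasing_by exact j.isLt

/-! ### Semantics -/

def ValTerm.eval {c : ℕ} (ρ : ℕ → Fin c) : ValTerm c → Fin c
  | .const v => v
  | .dummy y => ρ y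

/-- Truth of `δ` when the random variables have the values `x` and the summation variables have
been replaced with the values `ρ`. -/
def PropFormula.Holds {n c : ℕ} (x : Fin n → Fin c) (ρ : ℕ → Fin c) : PropFormula c → Prop
  | .eq X v => ∃ h : X < n, x ⟨X, h⟩ = v.eval ρ
  | .neg δ => ¬ δ.Holds x ρ
  | .conj δ δ' => δ.Holds x ρ ∧ δ'.Holds x ρ

/-- The probability of the event `δ` in the model. -/
noncomputable def SCM.probability {n c : ℕ} (𝔐 : SCM n c) (ρ : ℕ → Fin c)
    (δ : PropFormula c) : ℝ :=
  (𝔐.P {u | δ.Holds (𝔐.value u) ρ}).toReal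

/-- The value of a term. A conditional probability whose condition has probability zero is
given the value `0`. -/
noncomputable def ProbTerm.eval {n c : ℕ} (𝔐 : SCM n c) : (ℕ → Fin c) → ProbTerm c → ℝ
  | ρ, .prob δ => 𝔐.probability ρ δ
  | ρ, .cond δ δ' => 𝔐.probability ρ (.conj δ δ') / 𝔐.probability ρ δ'
  | ρ, .add e e' => e.eval 𝔐 ρ + e'.eval 𝔐 ρ
  | ρ, .mul e e' => e.eval 𝔐 ρ * e'.eval 𝔐 ρ
  | ρ, .sum y e => ∑ v : Fin c, e.eval 𝔐 (Function.update ρ y v)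

def ProbFormula.Holds {n c : ℕ} (𝔐 : SCM n c) (ρ : ℕ → Fin c) : ProbFormula c → Prop
  | .le e e' => e.eval 𝔐 ρ ≤ e'.eval 𝔐 ρ
  | .neg φ => ¬ φ.Holds 𝔐 ρ
  | .conj φ φ' => φ.Holds 𝔐 ρ ∧ φ'.Holds 𝔐 ρ

/-- `𝔐 ⊨ φ`. If `φ` is closed, its truth does not depend on `ρ`. -/
def SCM.Models {n c : ℕ} (𝔐 : SCM n c) (φ : ProbFormula c) : Prop :=
  ∀ ρ : ℕ → Fin c, φ.Holds 𝔐 ρ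

/-- The satisfiable formulas of the probabilistic language. -/
def SatProb (c : ℕ) : Set (ProbFormula c) :=
  {φ | φ.Closed ∧ ∃ n : ℕ, φ.VarsBelow n ∧ ∃ 𝔐 : SCM n c, 𝔐.Models φ}

/-! ### Formulas as strings -/

/-- The alphabet in which formulas are written. -/
inductive FSym : Type
  | one | sep | const | dummy | eq | neg | conj | prob | cond | add | mul | sum | le
  deriving DecidableEq

instance : Fintype FSym where
  elems := {.one, .sep, .const, .dummy, .eq, .neg, .conj, .prob, .cond, .add, .mul, .sum, .le}
  complete s := by cases s <;> simp

/-- The names of variables and the values are written in unary. After a renaming of the variables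
to an initial segment of the numbers, this is polynomially related to writing them in binary. -/
def FSym.num (n : ℕ) : List FSym := strokes FSym.one FSym.sep n

def ValTerm.encode {c : ℕ} : ValTerm c → List FSym
  | .const v => FSym.const :: FSym.num v
  | .dummy y => FSym.dummy :: FSym.num y

/-- Formulas are written in Polish notation. -/
def PropFormula.encode {c : ℕ} : PropFormula c → List FSym
  | .eq X x => FSym.eq :: (FSym.num X ++ x.encode)
  | .neg δ => FSym.neg :: δ.encode
  | .conj δ δ' => FSym.conj :: (δ.encode ++ δ'.encode)

def ProbTerm.encode {c : ℕ} : ProbTerm c → List FSym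
  | .prob δ => FSym.prob :: δ.encode
  | .cond δ δ' => FSym.cond :: (δ.encode ++ δ'.encode)
  | .add e e' => FSym.add :: (e.encode ++ e'.encode)
  | .mul e e' => FSym.mul :: (e.encode ++ e'.encode)
  | .sum y e => FSym.sum :: (FSym.num y ++ e.encode)

def ProbFormula.encode {c : ℕ} : ProbFormula c → List FSym
  | .le e e' => FSym.le :: (e.encode ++ e'.encode)
  | .neg φ => FSym.neg :: φ.encode
  | .conj φ φ' => FSym.conj :: (φ.encode ++ φ'.encode)

theorem FSym.num_append_inj {m n : ℕ} {s t : List FSym}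
    (h : FSym.num m ++ s = FSym.num n ++ t) : m = n ∧ s = t :=
  strokes_append_inj (by decide) h

theorem ValTerm.encode_append_inj {c : ℕ} {x x' : ValTerm c} {s t : List FSym}
    (h : x.encode ++ s = x'.encode ++ t) : x = x' ∧ s = t := by
  cases x <;> cases x' <;>
    simp only [ValTerm.encode, List.cons_append, List.cons.injEq, reduceCtorEq,
      true_and, false_and] at h
  · obtain ⟨h1, h2⟩ := FSym.num_append_inj h
    exact ⟨by rw [Fin.ext h1], h2⟩
  · obtain ⟨h1, h2⟩ := FSym.num_append_inj h
    exact ⟨by rw [h1], h2⟩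

theorem PropFormula.encode_append_inj {c : ℕ} (δ : PropFormula c) :
    ∀ {δ' : PropFormula c} {s t : List FSym},
      δ.encode ++ s = δ'.encode ++ t → δ = δ' ∧ s = t := by
  induction δ with
  | eq X x =>
    intro δ' s t h
    cases δ' <;>
      simp only [PropFormula.encode, List.cons_append, List.append_assoc, List.cons.injEq,
        reduceCtorEq, true_and, false_and] at h
    obtain ⟨rfl, h2⟩ := FSym.num_append_inj h
    obtain ⟨rfl, h3⟩ := ValTerm.encode_append_inj h2
    exact ⟨rfl, h3⟩
  | neg δ ih =>
    intro δ' s t h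
    cases δ' <;>
      simp only [PropFormula.encode, List.cons_append, List.append_assoc, List.cons.injEq,
        reduceCtorEq, true_and, false_and] at h
    obtain ⟨rfl, h3⟩ := ih h
    exact ⟨rfl, h3⟩
  | conj δ₁ δ₂ ih₁ ih₂ =>
    intro δ' s t h
    cases δ' <;>
      simp only [PropFormula.encode, List.cons_append, List.append_assoc, List.cons.injEq,
        reduceCtorEq, true_and, false_and] at h
    obtain ⟨rfl, h2⟩ := ih₁ h
    obtain ⟨rfl, h3⟩ := ih₂ h2
    exact ⟨rfl, h3⟩

theorem ProbTerm.encode_append_inj {c : ℕ} (e : ProbTerm c) :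
    ∀ {e' : ProbTerm c} {s t : List FSym},
      e.encode ++ s = e'.encode ++ t → e = e' ∧ s = t := by
  induction e with
  | prob δ =>
    intro e' s t h
    cases e' <;>
      simp only [ProbTerm.encode, List.cons_append, List.append_assoc, List.cons.injEq,
        reduceCtorEq, true_and, false_and] at h
    obtain ⟨rfl, h3⟩ := δ.encode_append_inj h
    exact ⟨rfl, h3⟩
  | cond δ₁ δ₂ =>
    intro e' s t h
    cases e' <;>
      simp only [ProbTerm.encode, List.cons_append, List.append_assoc, List.cons.injEq,
        reduceCtorEq, true_and, false_and] at h
    obtain ⟨rfl, h2⟩ := δ₁.encode_append_inj h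
    obtain ⟨rfl, h3⟩ := δ₂.encode_append_inj h2
    exact ⟨rfl, h3⟩
  | add e₁ e₂ ih₁ ih₂ =>
    intro e' s t h
    cases e' <;>
      simp only [ProbTerm.encode, List.cons_append, List.append_assoc, List.cons.injEq,
        reduceCtorEq, true_and, false_and] at h
    obtain ⟨rfl, h2⟩ := ih₁ h
    obtain ⟨rfl, h3⟩ := ih₂ h2
    exact ⟨rfl, h3⟩
  | mul e₁ e₂ ih₁ ih₂ =>
    intro e' s t h
    cases e' <;>
      simp only [ProbTerm.encode, List.cons_append, List.append_assoc, List.cons.injEq,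
        reduceCtorEq, true_and, false_and] at h
    obtain ⟨rfl, h2⟩ := ih₁ h
    obtain ⟨rfl, h3⟩ := ih₂ h2
    exact ⟨rfl, h3⟩
  | sum y e ih =>
    intro e' s t h
    cases e' <;>
      simp only [ProbTerm.encode, List.cons_append, List.append_assoc, List.cons.injEq,
        reduceCtorEq, true_and, false_and] at h
    obtain ⟨rfl, h2⟩ := FSym.num_append_inj h
    obtain ⟨rfl, h3⟩ := ih h2
    exact ⟨rfl, h3⟩

theorem ProbFormula.encode_append_inj {c : ℕ} (φ : ProbFormula c) :
    ∀ {φ' : ProbFormula c} {s t : List FSym},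
      φ.encode ++ s = φ'.encode ++ t → φ = φ' ∧ s = t := by
  induction φ with
  | le e₁ e₂ =>
    intro φ' s t h
    cases φ' <;>
      simp only [ProbFormula.encode, List.cons_append, List.append_assoc, List.cons.injEq,
        reduceCtorEq, true_and, false_and] at h
    obtain ⟨rfl, h2⟩ := e₁.encode_append_inj h
    obtain ⟨rfl, h3⟩ := e₂.encode_append_inj h2
    exact ⟨rfl, h3⟩
  | neg φ ih =>
    intro φ' s t h
    cases φ' <;>
      simp only [ProbFormula.encode, List.cons_append, List.append_assoc, List.cons.injEq,
        reduceCtorEq, true_and, false_and] at h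
    obtain ⟨rfl, h3⟩ := ih h
    exact ⟨rfl, h3⟩
  | conj φ₁ φ₂ ih₁ ih₂ =>
    intro φ' s t h
    cases φ' <;>
      simp only [ProbFormula.encode, List.cons_append, List.append_assoc, List.cons.injEq,
        reduceCtorEq, true_and, false_and] at h
    obtain ⟨rfl, h2⟩ := ih₁ h
    obtain ⟨rfl, h3⟩ := ih₂ h2
    exact ⟨rfl, h3⟩

theorem ProbFormula.encode_injective {c : ℕ} :
    Function.Injective (ProbFormula.encode (c := c)) := by
  intro φ φ' h
  exact (φ.encode_append_inj (congrArg (· ++ []) h)).1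

noncomputable def ProbFormula.encoding (c : ℕ) : Computability.Encoding (ProbFormula c) FSym :=
  encodingOfInjective ProbFormula.encode ProbFormula.encode_injective

/-! The number `x_e` is represented by the conditional probability `q_e = P(X₅ = 0 | E = e) = 4 x_e
+ 1/2`, where random variables `E_0, …, E_{N-1}` spell out the index `e`. This affine map carries
`[-1/8, 1/8]` onto `[0, 1]`, so the range constraints come for free. Let `q_i` be the probability at
the output of circuit `i`. The three equations at `j` become `q_0 = 1`, `L_1 = R_1`, `L_2 = R_2`
with polynomials over ℕ. As `q_0 ≤ 1`, they are equivalent to `(1 - q_0) + (L_1 - R_1)² + (L_2 -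
R_2)² ≤ 0`. Moving the negative terms to the other side gives an inequality without subtraction
whose reverse always holds (`right_le_left`).

All `j` are treated by one nested sum over values of the inputs, gates and outputs, in which every
layer carries the probability of a local event as a weight. These events link summation variables to
`X₀, …, X₄`, meant to be two bits, the negation of the first, their conjunction and their
disjunction. If all four rows of this truth table have positive probability, as the first conjunct
of the formula demands, then every evaluation of the circuits has positive weight. If moreover no
other rows occur, nothing else has positive weight.

Given a model, the inequality between the weighted sums forces equality in each summand of positive
weight (`le_of_weighted_le`), and those cover every `j` (`exists_path_layers`); spurious summands do
no harm. Given a solution, take uniform table bits, a uniform `E`, and `X₅` biased according to `E`.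
Then all summands of positive weight come from evaluations (`Path.layers_value`), and there both
sides agree.

The formula is written by a machine that interprets a stack of instructions and reads the input once
for each side of the inequality. An instruction takes one step and writes at most nine symbols, so a
bound on the steps also bounds the length of the output. -/

namespace SuccReduction

open Function Turing

/-! ## The formula of an instance -/

/-- The value that stands for a truth value. -/
def code {d : ℕ} (b : Bool) : Fin (d + 2) := if b then 1 else 0

theorem code_injective {d : ℕ} : Injective (code (d := d)) := by
  intro a b h
  cases a <;> cases b <;> simp_all [code]

/-- The summation variable for the value of a circuit node. -/
def node (u : ℕ) : ℕ := 8 * u + 7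

/-- The event that `X` has the value of the summation variable `y`. -/
def link {c : ℕ} (X y : ℕ) : PropFormula c := .eq X (.dummy y)

/-- A weighted sum `∑_y P(δ) * t`. -/
def layer {c : ℕ} (l : ℕ × PropFormula c) (t : ProbTerm c) : ProbTerm c :=
  .sum l.1 (.mul (.prob l.2) t)

def weighted {c : ℕ} (ls : List (ℕ × PropFormula c)) (t : ProbTerm c) : ProbTerm c :=
  ls.foldr layer t

/-! ### The layers of the nested sum, and the inequality as a polynomial over ℕ. -/

section Layers

variable {c : ℕ}

/-- The weight `P(X₀ = y)` only keeps `y` among the values that `X₀` attains; these layers produce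
the sum over all inputs `j`. -/
def inputLayers : ℕ → ℕ → List (ℕ × PropFormula c)
  | _, 0 => []
  | j, k + 1 => (node j, link 0 (node j)) :: inputLayers (j + 1) k

/-- `X₀` and `X₁` are the arguments in a truth table, `X₂`, `X₃`, `X₄` its columns for ¬, ∧, ∨. The
same five variables serve all gates, because every gate has a probability factor of its own. -/
def gateLayer {n : ℕ} : Gate n → ℕ × PropFormula c
  | .neg u => (node n, .conj (link 2 (node n)) (link 0 (node u)))
  | .conj u w => (node n, .conj (link 3 (node n)) (.conj (link 0 (node u)) (link 1 (node w))))
  | .disj u w => (node n, .conj (link 4 (node n)) (.conj (link 0 (node u)) (link 1 (node w))))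

def gateLayers : {n m : ℕ} → GateList n m → List (ℕ × PropFormula c)
  | _, _, .nil _ => []
  | _, _, .cons g rest => gateLayer g :: gateLayers rest

/-- The summation variable for output `k` of circuit `i`. -/
def outVar (M i k : ℕ) : ℕ := 8 * (M + k) + i

/-- The outputs are copied to names of their own, since the gates of the next circuit bind the same
node variables again. Both links use `X₀`, so the event is impossible unless the two values agree.
-/
def outLayers (M i : ℕ) : ℕ → List ℕ → List (ℕ × PropFormula c)
  | _, [] => []
  | k, u :: us =>
    (outVar M i k, .conj (link 0 (outVar M i k)) (link 0 (node u))) :: outLayers M i (k + 1) us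

def circuitLayers {M N : ℕ} (i : ℕ) (C : Circuit M N) : List (ℕ × PropFormula c) :=
  gateLayers C.gates ++ outLayers M i 0 (List.ofFn fun k => (C.out k : ℕ))

def circuitsLayers (I : SuccInstance) (is : List (Fin 7)) : List (ℕ × PropFormula c) :=
  (is.map fun i => circuitLayers i.val (I.C i)).flatten

def layers (I : SuccInstance) : List (ℕ × PropFormula c) :=
  inputLayers 0 I.M ++ circuitsLayers I (List.finRange 7)

/-- Polynomials with coefficients in `ℕ` in seven unknowns. -/
inductive NatPoly : Type
  | one
  | var (i : Fin 7)
  | add (p q : NatPoly)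
  | mul (p q : NatPoly)

def NatPoly.value (x : Fin 7 → ℝ) : NatPoly → ℝ
  | .one => 1
  | .var i => x i
  | .add p q => p.value x + q.value x
  | .mul p q => p.value x * q.value x

def NatPoly.double (p : NatPoly) : NatPoly := .add p p

/-- Substituting `x = (q - 1/2) / 4` turns `x₁ + x₂ = x₃` into `2 q₁ + 2 q₂ = 2 q₃ + 1`. -/
def sumLeft : NatPoly := (NatPoly.add (.var 1) (.var 2)).double

def sumRight : NatPoly := .add (NatPoly.var 3).double .one

/-- The same substitution turns `x₄ x₅ = x₆` into `4 q₄ q₅ + 9 = 16 q₆ + 2 (q₄ + q₅)`. -/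
def prodLeft : NatPoly :=
  .add (NatPoly.mul (.var 4) (.var 5)).double.double (.add NatPoly.one.double.double.double .one)

def prodRight : NatPoly :=
  .add (NatPoly.var 6).double.double.double.double (NatPoly.add (.var 4) (.var 5)).double

/-- Both sides of the inequality that the values of the seven outputs have to satisfy. -/
def side (left : Bool) : NatPoly :=
  -- Terms have no subtraction, so `(L - R)² ≤ 0` is written as `L² + R² ≤ 2 L R`, and `1 - q₀ ≤ 0`
  -- as `1 ≤ q₀`.
  if left then
    .add .one (.add (.add (.mul sumLeft sumLeft) (.mul sumRight sumRight))
      (.add (.mul prodLeft prodLeft) (.mul prodRight prodRight)))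
  else
    .add (.var 0) (.add (NatPoly.mul sumLeft sumRight).double (NatPoly.mul prodLeft prodRight).double)

theorem side_value (q : Fin 7 → ℝ) :
    (side true).value q - (side false).value q =
      (1 - q 0) + (2 * q 1 + 2 * q 2 - (2 * q 3 + 1)) ^ 2 +
        (4 * (q 4 * q 5) + 9 - (16 * q 6 + 2 * (q 4 + q 5))) ^ 2 := by
  simp [side, NatPoly.value, NatPoly.double, sumLeft, sumRight, prodLeft, prodRight]
  ring

end Layers

/-! ### Events, terms and the formula of an instance. -/

section Formula

variable {d : ℕ}

/-- Impossible because 0 and 1 are distinct values. Its probability supplies the constant 0, that of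
its negation the constant 1. -/
def falsum : PropFormula (d + 2) := .conj (.eq 0 (.const 0)) (.eq 0 (.const 1))

/-- The random variables `E₀, …, E_{N-1}` have the values that circuit `i` puts out. -/
def event (M i : ℕ) : ℕ → PropFormula (d + 2)
  | 0 => .neg falsum
  -- Here `outVar M 7 k` names the random variable `E_k`. It is at least 7, hence none of `X₀, …,
  -- X₅`; that it is also the number of a node is harmless, since summation variables are numbered
  -- separately.
  | k + 1 => .conj (link (outVar M 7 k) (outVar M i k)) (event M i k)

def NatPoly.toTerm (M N : ℕ) : NatPoly → ProbTerm (d + 2)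
  | .one => .prob (.neg falsum)
  | .var i => .cond (.eq 5 (.const 0)) (event M i N)
  | .add p q => .add (p.toTerm M N) (q.toTerm M N)
  | .mul p q => .mul (p.toTerm M N) (q.toTerm M N)

/-- One row of the truth tables of the three kinds of gates. -/
def tableRow (a b : Bool) : PropFormula (d + 2) :=
  .conj (.eq 0 (.const (code a))) (.conj (.eq 1 (.const (code b)))
    (.conj (.eq 2 (.const (code !a))) (.conj (.eq 3 (.const (code (a && b))))
      (.eq 4 (.const (code (a || b)))))))

/-- A product of probabilities is positive iff every factor is, so one strict inequality covers all
four rows. -/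
def tableProduct : ProbTerm (d + 2) :=
  .mul (.mul (.prob (tableRow false false)) (.prob (tableRow false true)))
    (.mul (.prob (tableRow true false)) (.prob (tableRow true true)))

def sideTerm (I : SuccInstance) (left : Bool) : ProbTerm (d + 2) :=
  weighted (layers I) ((side left).toTerm I.M I.N)

def formula (d : ℕ) (I : SuccInstance) : ProbFormula (d + 2) :=
  .conj (.neg (.le tableProduct (.prob falsum)))
    (.le (sideTerm I true) (sideTerm I false))

end Formula

/-! ## The formula is closed -/

section Bound

variable {c : ℕ}

def BoundLayers : Set ℕ → List (ℕ × PropFormula c) → Prop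
  | _, [] => True
  | B, l :: ls => l.2.BoundIn (insert l.1 B) ∧ BoundLayers (insert l.1 B) ls

def names (ls : List (ℕ × PropFormula c)) : Set ℕ := {y | y ∈ ls.map Prod.fst}

theorem names_nil : names ([] : List (ℕ × PropFormula c)) = ∅ := by
  simp [names]

theorem names_cons (l : ℕ × PropFormula c) (ls) : names (l :: ls) = insert l.1 (names ls) := by
  ext y
  simp [names]

theorem names_append (l l' : List (ℕ × PropFormula c)) : names (l ++ l') = names l ∪ names l' := by
  ext y
  simp [names]

theorem weighted_boundIn (ls : List (ℕ × PropFormula c)) (t : ProbTerm c) :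
    ∀ B, BoundLayers B ls → t.BoundIn (B ∪ names ls) → (weighted ls t).BoundIn B := by
  induction ls with
  | nil =>
    intro B _ h
    simpa [weighted, names_nil] using h
  | cons l ls ih =>
    rintro B ⟨h1, h2⟩ h
    refine ⟨h1, ih _ h2 ?_⟩
    rwa [names_cons, Set.union_insert, ← Set.insert_union] at h

theorem boundLayers_append (l l' : List (ℕ × PropFormula c)) :
    ∀ B, BoundLayers B l → BoundLayers (B ∪ names l) l' → BoundLayers B (l ++ l') := by
  induction l with
  | nil =>
    intro B _ h
    simpa [names_nil] using h
  | cons a l ih =>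
    rintro B ⟨h1, h2⟩ h
    refine ⟨h1, ih _ h2 ?_⟩
    rwa [names_cons, Set.union_insert, ← Set.insert_union] at h

theorem link_boundIn (B : Set ℕ) (X y : ℕ) : (link X y : PropFormula c).BoundIn B ↔ y ∈ B :=
  Iff.rfl

theorem inputLayers_bound (k : ℕ) : ∀ (j : ℕ) (B : Set ℕ),
    BoundLayers B (inputLayers (c := c) j k) := by
  induction k with
  | zero => intros; trivial
  | succ k ih => exact fun j B => ⟨by simp [link_boundIn], ih _ _⟩

theorem names_inputLayers (k : ℕ) : ∀ (j u : ℕ), j ≤ u → u < j + k →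
    node u ∈ names (inputLayers (c := c) j k) := by
  induction k with
  | zero => intros; omega
  | succ k ih =>
    intro j u h1 h2
    rw [inputLayers, names_cons]
    rcases h1.eq_or_lt with rfl | h1
    · exact Set.mem_insert _ _
    · exact Set.mem_insert_of_mem _ (ih _ _ h1 (by omega))

theorem gateLayers_bound {n m : ℕ} (G : GateList n m) : ∀ B : Set ℕ, (∀ u < n, node u ∈ B) →
    BoundLayers B (gateLayers (c := c) G) ∧ ∀ u < m, node u ∈ B ∪ names (gateLayers (c := c) G) := by
  induction G with
  | nil n => exact fun B h => ⟨trivial, fun u hu => Or.inl (h u hu)⟩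
  | @cons n m g rest ih =>
    intro B h
    have h' : ∀ u < n + 1, node u ∈ insert (node n) B := by
      intro u hu
      rcases Nat.lt_succ_iff_lt_or_eq.mp hu with hu | rfl
      · exact Set.mem_insert_of_mem _ (h u hu)
      · exact Set.mem_insert _ _
    have e : (gateLayer (c := c) g).1 = node n := by cases g <;> rfl
    obtain ⟨h1, h2⟩ := ih _ h'
    refine ⟨⟨?_, by rwa [e]⟩, fun u hu => ?_⟩
    · cases g <;> simp [gateLayer, PropFormula.BoundIn, link_boundIn, h _ (Fin.is_lt _)]
    · rw [gateLayers, names_cons, e, Set.union_insert, ← Set.insert_union]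
      exact h2 u hu

theorem outLayers_bound (M i : ℕ) (us : List ℕ) : ∀ (k : ℕ) (B : Set ℕ), (∀ u ∈ us, node u ∈ B) →
    BoundLayers B (outLayers (c := c) M i k us) := by
  induction us with
  | nil => intros; trivial
  | cons u us ih =>
    intro k B h
    refine ⟨⟨by simp [link_boundIn], ?_⟩, ih _ _ fun w hw => ?_⟩
    · exact Set.mem_insert_of_mem _ (h u (by simp))
    · exact Set.mem_insert_of_mem _ (h w (by simp [hw]))

theorem names_outLayers (M i : ℕ) (us : List ℕ) : ∀ (k : ℕ), ∀ t < us.length,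
    outVar M i (k + t) ∈ names (outLayers (c := c) M i k us) := by
  induction us with
  | nil => intro k t h; simp at h
  | cons u us ih =>
    intro k t h
    rw [outLayers, names_cons]
    rcases t with _ | t
    · exact Set.mem_insert _ _
    · have := ih (k + 1) t (by simpa using h)
      rw [show k + 1 + t = k + (t + 1) by omega] at this
      exact Set.mem_insert_of_mem _ this

theorem circuitLayers_bound {M N : ℕ} (i : ℕ) (C : Circuit M N) (B : Set ℕ)
    (h : ∀ u < M, node u ∈ B) : BoundLayers B (circuitLayers (c := c) i C) := by
  obtain ⟨h1, h2⟩ := gateLayers_bound (c := c) C.gates B h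
  refine boundLayers_append _ _ _ h1 (outLayers_bound _ _ _ _ _ ?_)
  intro u hu
  obtain ⟨k, rfl⟩ := (List.mem_ofFn' _ _).mp hu
  exact h2 _ (Fin.is_lt _)

theorem names_circuitLayers {M N : ℕ} (i : ℕ) (C : Circuit M N) (k : ℕ) (hk : k < N) :
    outVar M i k ∈ names (circuitLayers (c := c) i C) := by
  rw [circuitLayers, names_append]
  have := names_outLayers (c := c) M i (List.ofFn fun k => (C.out k : ℕ)) 0 k (by simpa using hk)
  rw [Nat.zero_add] at this
  exact Or.inr this

theorem circuitsLayers_bound (I : SuccInstance) (is : List (Fin 7)) : ∀ B : Set ℕ,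
    (∀ u < I.M, node u ∈ B) → BoundLayers B (circuitsLayers (c := c) I is) := by
  induction is with
  | nil => intros; trivial
  | cons i is ih =>
    intro B h
    refine boundLayers_append _ _ _ (circuitLayers_bound _ _ _ h) (ih _ fun u hu => Or.inl (h u hu))

theorem names_circuitsLayers (I : SuccInstance) (is : List (Fin 7)) (i : Fin 7) (hi : i ∈ is)
    (k : ℕ) (hk : k < I.N) : outVar I.M i k ∈ names (circuitsLayers (c := c) I is) := by
  have := names_circuitLayers (c := c) i.val (I.C i) k hk
  simp only [names, circuitsLayers, Set.mem_ofPred_eq, List.mem_map, List.mem_flatten] at this ⊢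
  obtain ⟨l, hl, e⟩ := this
  exact ⟨l, ⟨_, ⟨i, hi, rfl⟩, hl⟩, e⟩

theorem layers_bound (I : SuccInstance) : BoundLayers ∅ (layers (c := c) I) := by
  refine boundLayers_append _ _ _ (inputLayers_bound _ _ _) (circuitsLayers_bound _ _ _ ?_)
  exact fun u hu => Or.inr (names_inputLayers _ _ _ (Nat.zero_le _) (by simpa using hu))

theorem names_layers (I : SuccInstance) (i : Fin 7) (k : ℕ) (hk : k < I.N) :
    outVar I.M i k ∈ names (layers (c := c) I) := by
  rw [layers, names_append]
  exact Or.inr (names_circuitsLayers I _ i (List.mem_finRange i) k hk)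

variable {d : ℕ}

theorem falsum_boundIn (B : Set ℕ) : (falsum (d := d)).BoundIn B := ⟨trivial, trivial⟩

theorem event_boundIn (M i : ℕ) (B : Set ℕ) : ∀ N : ℕ, (∀ k < N, outVar M i k ∈ B) →
    (event (d := d) M i N).BoundIn B
  | 0, _ => falsum_boundIn B
  | N + 1, h => ⟨h N (by omega), event_boundIn M i B N fun k hk => h k (by omega)⟩

theorem toTerm_boundIn (M N : ℕ) (B : Set ℕ) (h : ∀ i : Fin 7, ∀ k < N, outVar M i k ∈ B)
    (p : NatPoly) : (p.toTerm (d := d) M N).BoundIn B := by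
  induction p with
  | one => exact falsum_boundIn B
  | var i => exact ⟨trivial, event_boundIn _ _ _ _ (h i)⟩
  | add p q hp hq => exact ⟨hp, hq⟩
  | mul p q hp hq => exact ⟨hp, hq⟩

theorem sideTerm_boundIn (I : SuccInstance) (left : Bool) :
    (sideTerm (d := d) I left).BoundIn ∅ :=
  weighted_boundIn _ _ _ (layers_bound I)
    (toTerm_boundIn _ _ _ (fun i k hk => Or.inr (names_layers I i k hk)) _)

theorem tableRow_boundIn (a b : Bool) (B : Set ℕ) : (tableRow (d := d) a b).BoundIn B :=
  ⟨trivial, trivial, trivial, trivial, trivial⟩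

theorem formula_closed (I : SuccInstance) : (formula d I).Closed :=
  ⟨⟨⟨⟨tableRow_boundIn _ _ _, tableRow_boundIn _ _ _⟩,
    tableRow_boundIn _ _ _, tableRow_boundIn _ _ _⟩, falsum_boundIn _⟩,
    sideTerm_boundIn _ _, sideTerm_boundIn _ _⟩

end Bound

/-! ## The random variables of the formula -/

section Vars

variable {c d : ℕ}

theorem weighted_varsBelow {n : ℕ} (ls : List (ℕ × PropFormula c)) (t : ProbTerm c)
    (h : ∀ l ∈ ls, l.2.VarsBelow n) (ht : t.VarsBelow n) : (weighted ls t).VarsBelow n := by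
  induction ls with
  | nil => exact ht
  | cons l ls ih =>
    exact ⟨h l (by simp), ih fun l' hl' => h l' (by simp [hl'])⟩

theorem link_varsBelow (n X y : ℕ) : (link X y : PropFormula c).VarsBelow n ↔ X < n :=
  Iff.rfl

theorem inputLayers_varsBelow {n : ℕ} (hn : 6 ≤ n) (k : ℕ) : ∀ j : ℕ,
    ∀ l ∈ inputLayers (c := c) j k, l.2.VarsBelow n := by
  induction k with
  | zero => simp [inputLayers]
  | succ k ih =>
    intro j l hl
    rcases List.mem_cons.mp hl with rfl | hl
    · rw [link_varsBelow]; omega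
    · exact ih _ l hl

theorem gateLayers_varsBelow {n a b : ℕ} (hn : 6 ≤ n) (G : GateList a b) :
    ∀ l ∈ gateLayers (c := c) G, l.2.VarsBelow n := by
  induction G with
  | nil => simp [gateLayers]
  | cons g rest ih =>
    intro l hl
    rcases List.mem_cons.mp hl with rfl | hl
    · cases g <;> simp only [gateLayer, PropFormula.VarsBelow, link_varsBelow] <;> omega
    · exact ih l hl

theorem outLayers_varsBelow {n : ℕ} (hn : 6 ≤ n) (M i : ℕ) (us : List ℕ) : ∀ k : ℕ,
    ∀ l ∈ outLayers (c := c) M i k us, l.2.VarsBelow n := by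
  induction us with
  | nil => simp [outLayers]
  | cons u us ih =>
    intro k l hl
    rcases List.mem_cons.mp hl with rfl | hl
    · simp only [PropFormula.VarsBelow, link_varsBelow]; omega
    · exact ih _ l hl

theorem layers_varsBelow {n : ℕ} (hn : 6 ≤ n) (I : SuccInstance) :
    ∀ l ∈ layers (c := c) I, l.2.VarsBelow n := by
  intro l hl
  rcases List.mem_append.mp hl with hl | hl
  · exact inputLayers_varsBelow hn _ _ l hl
  · simp only [circuitsLayers, List.mem_flatten, List.mem_map] at hl
    obtain ⟨_, ⟨i, -, rfl⟩, hl⟩ := hl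
    rcases List.mem_append.mp hl with hl | hl
    · exact gateLayers_varsBelow hn _ l hl
    · exact outLayers_varsBelow hn _ _ _ _ l hl

theorem falsum_varsBelow {n : ℕ} (hn : 6 ≤ n) : (falsum (d := d)).VarsBelow n := by
  simp only [falsum, PropFormula.VarsBelow]; omega

theorem event_varsBelow {n : ℕ} (hn : 6 ≤ n) (M i : ℕ) : ∀ N : ℕ, (∀ k < N, outVar M 7 k < n) →
    (event (d := d) M i N).VarsBelow n
  | 0, _ => falsum_varsBelow hn
  | N + 1, h => ⟨h N (by omega), event_varsBelow hn M i N fun k hk => h k (by omega)⟩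

theorem toTerm_varsBelow {n : ℕ} (hn : 6 ≤ n) (M N : ℕ) (h : ∀ k < N, outVar M 7 k < n)
    (p : NatPoly) : (p.toTerm (d := d) M N).VarsBelow n := by
  induction p with
  | one => exact falsum_varsBelow hn
  | var i => exact ⟨by simp only [PropFormula.VarsBelow]; omega, event_varsBelow hn _ _ _ h⟩
  | add p q hp hq => exact ⟨hp, hq⟩
  | mul p q hp hq => exact ⟨hp, hq⟩

theorem formula_varsBelow {n : ℕ} (hn : 6 ≤ n) (I : SuccInstance)
    (h : ∀ k < I.N, outVar I.M 7 k < n) : (formula d I).VarsBelow n := by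
  have hs := fun left => weighted_varsBelow (layers (c := d + 2) I) ((side left).toTerm I.M I.N)
    (layers_varsBelow hn I) (toTerm_varsBelow hn _ _ h _)
  refine ⟨?_, hs _, hs _⟩
  simp only [ProbFormula.VarsBelow, tableProduct, ProbTerm.VarsBelow, tableRow, falsum,
    PropFormula.VarsBelow]
  omega

end Vars

/-! ## Weighted sums and their summands of positive weight -/

section Path

variable {n c : ℕ} (𝔐 : SCM n c)

theorem probability_nonneg (ρ : ℕ → Fin c) (δ : PropFormula c) : 0 ≤ 𝔐.probability ρ δ :=
  ENNReal.toReal_nonneg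

theorem probability_mono {ρ ρ' : ℕ → Fin c} {δ δ' : PropFormula c}
    (h : ∀ x : Fin n → Fin c, δ.Holds x ρ → δ'.Holds x ρ') :
    𝔐.probability ρ δ ≤ 𝔐.probability ρ' δ' := by
  have := 𝔐.isProbabilityMeasure
  exact ENNReal.toReal_mono (MeasureTheory.measure_ne_top _ _)
    (MeasureTheory.measure_mono fun u hu => h _ hu)

/-- `ρ'` arises from `ρ` by a choice of values for the summation variables of the layers such that
all weights are positive. -/
def Path : List (ℕ × PropFormula c) → (ℕ → Fin c) → (ℕ → Fin c) → Prop
  | [], ρ, ρ' => ρ' = ρ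
  | l :: ls, ρ, ρ' => ∃ v, 0 < 𝔐.probability (update ρ l.1 v) l.2 ∧ Path ls (update ρ l.1 v) ρ'

theorem path_append (l l' : List (ℕ × PropFormula c)) : ∀ ρ ρ'' : ℕ → Fin c,
    Path 𝔐 (l ++ l') ρ ρ'' ↔ ∃ ρ', Path 𝔐 l ρ ρ' ∧ Path 𝔐 l' ρ' ρ'' := by
  induction l with
  | nil => simp [Path]
  | cons a l ih =>
    intro ρ ρ''
    simp only [List.cons_append, Path, ih]
    constructor
    · rintro ⟨v, h1, ρ', h2, h3⟩
      exact ⟨ρ', ⟨v, h1, h2⟩, h3⟩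
    · rintro ⟨ρ', ⟨v, h1, h2⟩, h3⟩
      exact ⟨v, h1, ρ', h2, h3⟩

theorem Path.eq_of_notMem {ls : List (ℕ × PropFormula c)} : ∀ {ρ ρ' : ℕ → Fin c},
    Path 𝔐 ls ρ ρ' → ∀ y, (∀ l ∈ ls, l.1 ≠ y) → ρ' y = ρ y := by
  induction ls with
  | nil => rintro ρ ρ' rfl y _; rfl
  | cons l ls ih =>
    rintro ρ ρ' ⟨v, -, h⟩ y hy
    rw [ih h y fun l' hl' => hy l' (by simp [hl']), update_of_ne (hy l (by simp)).symm]

theorem weighted_eval_cons (l : ℕ × PropFormula c) (ls) (t : ProbTerm c) (ρ : ℕ → Fin c) :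
    (weighted (l :: ls) t).eval 𝔐 ρ = ∑ v : Fin c,
      𝔐.probability (update ρ l.1 v) l.2 * (weighted ls t).eval 𝔐 (update ρ l.1 v) := rfl

/-- A weight zero annihilates everything below it, so only choices of positive weight have to be
compared. -/
theorem weighted_le {t t' : ProbTerm c} (ls : List (ℕ × PropFormula c)) : ∀ ρ : ℕ → Fin c,
    (∀ ρ', Path 𝔐 ls ρ ρ' → t.eval 𝔐 ρ' ≤ t'.eval 𝔐 ρ') →
    (weighted ls t).eval 𝔐 ρ ≤ (weighted ls t').eval 𝔐 ρ := by
  induction ls with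
  | nil => exact fun ρ h => h ρ rfl
  | cons l ls ih =>
    intro ρ h
    rw [weighted_eval_cons, weighted_eval_cons]
    refine Finset.sum_le_sum fun v _ => ?_
    rcases (probability_nonneg 𝔐 (update ρ l.1 v) l.2).eq_or_lt with h0 | h0
    · simp [← h0]
    · exact mul_le_mul_of_nonneg_left (ih _ fun ρ' hρ' => h ρ' ⟨v, h0, hρ'⟩) h0.le

/-- Termwise `t'` is at most `t`, so the opposite inequality of the sums forces equality in every
summand. A positive weight can then be cancelled, and the argument descends one layer. -/
theorem le_of_weighted_le {t t' : ProbTerm c} (hle : ∀ ρ, t'.eval 𝔐 ρ ≤ t.eval 𝔐 ρ)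
    (ls : List (ℕ × PropFormula c)) : ∀ ρ : ℕ → Fin c,
    (weighted ls t).eval 𝔐 ρ ≤ (weighted ls t').eval 𝔐 ρ →
    ∀ ρ', Path 𝔐 ls ρ ρ' → t.eval 𝔐 ρ' ≤ t'.eval 𝔐 ρ' := by
  induction ls with
  | nil => rintro ρ h ρ' rfl; exact h
  | cons l ls ih =>
    rintro ρ h ρ' ⟨v, h0, hρ'⟩
    refine ih _ ?_ ρ' hρ'
    rw [weighted_eval_cons, weighted_eval_cons] at h
    have hv : ∀ w ∈ Finset.univ, 𝔐.probability (update ρ l.1 w) l.2 *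
        (weighted ls t').eval 𝔐 (update ρ l.1 w) ≤ 𝔐.probability (update ρ l.1 w) l.2 *
        (weighted ls t).eval 𝔐 (update ρ l.1 w) := fun w _ =>
      mul_le_mul_of_nonneg_left (weighted_le 𝔐 ls _ fun _ _ => hle _) (probability_nonneg _ _ _)
    have heq := (Finset.sum_eq_sum_iff_of_le hv).mp (le_antisymm (Finset.sum_le_sum hv) h) v
      (Finset.mem_univ v)
    exact (le_of_mul_le_mul_left heq.ge h0)

end Path

/-! ## Paths evaluate the circuits -/

section Names

variable {c : ℕ}

theorem node_injective : Injective node := fun a b h => by simp only [node] at h; omega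

/-- Names are separated modulo 8: residue 7 for nodes, residue `i < 7` for the outputs of circuit
`i`. -/
theorem node_ne_outVar (u M k : ℕ) (i : Fin 7) : node u ≠ outVar M i k := by
  simp only [node, outVar]; omega

theorem outVar_inj {M k k' : ℕ} {i i' : Fin 7} (h : outVar M i k = outVar M i' k') :
    i = i' ∧ k = k' := by
  simp only [outVar] at h
  exact ⟨Fin.ext (by omega), by omega⟩

theorem fst_gateLayers {n m : ℕ} (G : GateList n m) : ∀ l ∈ gateLayers (c := c) G,
    ∃ u, n ≤ u ∧ l.1 = node u := by
  induction G with
  | nil => simp [gateLayers]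
  | @cons n m g rest ih =>
    intro l hl
    rcases List.mem_cons.mp hl with rfl | hl
    · exact ⟨n, le_rfl, by cases g <;> rfl⟩
    · obtain ⟨u, hu, e⟩ := ih l hl
      exact ⟨u, by omega, e⟩

theorem fst_outLayers (M i : ℕ) (us : List ℕ) : ∀ k : ℕ, ∀ l ∈ outLayers (c := c) M i k us,
    ∃ k', k ≤ k' ∧ l.1 = outVar M i k' := by
  induction us with
  | nil => simp [outLayers]
  | cons u us ih =>
    intro k l hl
    rcases List.mem_cons.mp hl with rfl | hl
    · exact ⟨k, le_rfl, rfl⟩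
    · obtain ⟨k', h, e⟩ := ih _ l hl
      exact ⟨k', by omega, e⟩

theorem fst_circuitLayers {M N : ℕ} (i : Fin 7) (C : Circuit M N) :
    ∀ l ∈ circuitLayers (c := c) i C, (∃ u, M ≤ u ∧ l.1 = node u) ∨ ∃ k, l.1 = outVar M i k := by
  intro l hl
  rcases List.mem_append.mp hl with hl | hl
  · exact Or.inl (fst_gateLayers _ l hl)
  · obtain ⟨k, -, e⟩ := fst_outLayers _ _ _ _ l hl
    exact Or.inr ⟨k, e⟩

end Names

/-! ### Positive weights and the truth tables of gates. -/

section Circuits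

variable {n d : ℕ} (𝔐 : SCM n (d + 2))

/-- Every row of the truth tables has positive probability. -/
def HasRows : Prop := ∀ ρ a b, 0 < 𝔐.probability ρ (tableRow a b)

/-- Almost surely, the values obey the truth tables. -/
def OnlyRows : Prop := ∀ ρ (δ : PropFormula (d + 2)), 0 < 𝔐.probability ρ δ →
  ∃ (x : Fin n → Fin (d + 2)) (a b : Bool), (tableRow a b).Holds x ρ ∧ δ.Holds x ρ

variable {𝔐}

theorem HasRows.pos (H : HasRows 𝔐) {ρ : ℕ → Fin (d + 2)} {δ : PropFormula (d + 2)} (a b : Bool)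
    (h : ∀ x : Fin n → Fin (d + 2), (tableRow a b).Holds x ρ → δ.Holds x ρ) :
    0 < 𝔐.probability ρ δ :=
  (H ρ a b).trans_le (probability_mono 𝔐 h)

theorem tableRow_holds {x : Fin n → Fin (d + 2)} {ρ : ℕ → Fin (d + 2)} {a b : Bool} :
    (tableRow a b).Holds x ρ ↔ (∃ h : 0 < n, x ⟨0, h⟩ = code a) ∧ (∃ h : 1 < n, x ⟨1, h⟩ = code b) ∧
      (∃ h : 2 < n, x ⟨2, h⟩ = code !a) ∧ (∃ h : 3 < n, x ⟨3, h⟩ = code (a && b)) ∧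
      (∃ h : 4 < n, x ⟨4, h⟩ = code (a || b)) := Iff.rfl

theorem link_holds {x : Fin n → Fin (d + 2)} {ρ : ℕ → Fin (d + 2)} {X y : ℕ} :
    (link X y).Holds x ρ ↔ ∃ h : X < n, x ⟨X, h⟩ = ρ y := Iff.rfl

theorem conj_holds {x : Fin n → Fin (d + 2)} {ρ : ℕ → Fin (d + 2)} {δ δ' : PropFormula (d + 2)} :
    (PropFormula.conj δ δ').Holds x ρ ↔ δ.Holds x ρ ∧ δ'.Holds x ρ := Iff.rfl

/-- The table row that belongs to the arguments of the gate implies the event of the gate. -/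
theorem gate_weight_pos (H : HasRows 𝔐) {a : ℕ} (g : Gate a) (v : Fin a → Bool)
    {ρ : ℕ → Fin (d + 2)} (hv : ∀ u : Fin a, ρ (node u) = code (v u))
    (hg : ρ (node a) = code (g.eval v)) : 0 < 𝔐.probability ρ (gateLayer g).2 := by
  cases g with
  | neg u =>
    -- A negation does not look at `X₁`; the second bit of the row is arbitrary.
    refine H.pos (v u) (v u) fun x => ?_
    rw [tableRow_holds, gateLayer, conj_holds, link_holds, link_holds, hv, hg]
    exact fun h => ⟨h.2.2.1, h.1⟩
  | conj u w =>
    refine H.pos (v u) (v w) fun x => ?_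
    rw [tableRow_holds, gateLayer, conj_holds, conj_holds, link_holds, link_holds, link_holds,
      hv, hv, hg]
    exact fun h => ⟨h.2.2.2.1, h.1, h.2.1⟩
  | disj u w =>
    refine H.pos (v u) (v w) fun x => ?_
    rw [tableRow_holds, gateLayer, conj_holds, conj_holds, link_holds, link_holds, link_holds,
      hv, hv, hg]
    exact fun h => ⟨h.2.2.2.2, h.1, h.2.1⟩

/-- An event of positive probability meets some table row. The links to `X₀` and `X₁` determine its
relevant arguments, and the column of the gate then gives the value. -/
theorem gate_value (S : OnlyRows 𝔐) {a : ℕ} (g : Gate a) (v : Fin a → Bool)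
    {ρ : ℕ → Fin (d + 2)} (hv : ∀ u : Fin a, ρ (node u) = code (v u))
    (hg : 0 < 𝔐.probability ρ (gateLayer g).2) : ρ (node a) = code (g.eval v) := by
  obtain ⟨x, p, q, h, h'⟩ := S _ _ hg
  obtain ⟨⟨_, h0⟩, ⟨_, h1⟩, ⟨_, h2⟩, ⟨_, h3⟩, ⟨_, h4⟩⟩ := tableRow_holds.mp h
  cases g with
  | neg u =>
    rw [gateLayer, conj_holds, link_holds, link_holds, hv] at h'
    obtain ⟨⟨_, e2⟩, _, e0⟩ := h'
    obtain rfl := code_injective (h0.symm.trans e0)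
    exact e2.symm.trans h2
  | conj u w =>
    rw [gateLayer, conj_holds, conj_holds, link_holds, link_holds, link_holds, hv, hv] at h'
    obtain ⟨⟨_, e2⟩, ⟨_, e0⟩, _, e1⟩ := h'
    obtain rfl := code_injective (h0.symm.trans e0)
    obtain rfl := code_injective (h1.symm.trans e1)
    exact e2.symm.trans h3
  | disj u w =>
    rw [gateLayer, conj_holds, conj_holds, link_holds, link_holds, link_holds, hv, hv] at h'
    obtain ⟨⟨_, e2⟩, ⟨_, e0⟩, _, e1⟩ := h'
    obtain rfl := code_injective (h0.symm.trans e0)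
    obtain rfl := code_injective (h1.symm.trans e1)
    exact e2.symm.trans h4

theorem coded_snoc {a : ℕ} {v : Fin a → Bool} {ρ : ℕ → Fin (d + 2)}
    (hv : ∀ u : Fin a, ρ (node u) = code (v u)) (b : Bool) (u : Fin (a + 1)) :
    update ρ (node a) (code b) (node u) = code (Fin.snoc (α := fun _ => Bool) v b u) := by
  refine Fin.lastCases ?_ (fun u => ?_) u
  · simp
  · rw [Fin.snoc_castSucc, update_of_ne, ← hv u]
    · rfl
    · exact node_injective.ne (by simp; omega)

theorem update_node {a : ℕ} {v : Fin a → Bool} {ρ : ℕ → Fin (d + 2)}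
    (hv : ∀ u : Fin a, ρ (node u) = code (v u)) (z : Fin (d + 2)) (u : Fin a) :
    update ρ (node a) z (node u) = code (v u) := by
  rw [update_of_ne (node_injective.ne (by omega)), hv]

theorem fst_gateLayer {c a : ℕ} (g : Gate a) : (gateLayer (c := c) g).1 = node a := by
  cases g <;> rfl

theorem exists_path_gateLayers (H : HasRows 𝔐) {a m : ℕ} (G : GateList a m) :
    ∀ (v : Fin a → Bool) (ρ : ℕ → Fin (d + 2)), (∀ u : Fin a, ρ (node u) = code (v u)) →
      ∃ ρ', Path 𝔐 (gateLayers G) ρ ρ' ∧ ∀ u : Fin m, ρ' (node u) = code (G.eval v u) := by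
  induction G with
  | nil => exact fun v ρ hv => ⟨ρ, rfl, hv⟩
  | @cons a m g rest ih =>
    intro v ρ hv
    obtain ⟨ρ', h1, h2⟩ := ih (Fin.snoc (α := fun _ => Bool) v (g.eval v)) _ (coded_snoc hv _)
    refine ⟨ρ', ⟨code (g.eval v), ?_, ?_⟩, h2⟩ <;> rw [fst_gateLayer]
    · exact gate_weight_pos H g v (update_node hv _) (update_self _ _ _)
    · exact h1

theorem Path.gateLayers_value (S : OnlyRows 𝔐) {a m : ℕ} (G : GateList a m) :
    ∀ (v : Fin a → Bool) (ρ ρ' : ℕ → Fin (d + 2)), (∀ u : Fin a, ρ (node u) = code (v u)) →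
      Path 𝔐 (gateLayers G) ρ ρ' → ∀ u : Fin m, ρ' (node u) = code (G.eval v u) := by
  induction G with
  | nil => rintro v ρ _ hv rfl; exact hv
  | @cons a m g rest ih =>
    rintro v ρ ρ' hv ⟨z, h1, h2⟩
    rw [fst_gateLayer] at h1 h2
    have hz := gate_value S g v (update_node hv z) h1
    rw [update_self] at hz
    subst hz
    exact ih _ _ _ (coded_snoc hv _) h2

/-- The copied values must be codes of bits, because positive probability is known for no other
values of `X₀`. -/
theorem exists_path_outLayers (H : HasRows 𝔐) (M : ℕ) (i : Fin 7) (us : List ℕ) :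
    ∀ (k : ℕ) (ρ : ℕ → Fin (d + 2)), (∀ u ∈ us, ∃ b, ρ (node u) = code b) →
      ∃ ρ', Path 𝔐 (outLayers M i k us) ρ ρ' := by
  induction us with
  | nil => exact fun k ρ _ => ⟨ρ, rfl⟩
  | cons u us ih =>
    intro k ρ h
    obtain ⟨b, hb⟩ := h u (by simp)
    obtain ⟨ρ', hρ'⟩ := ih (k + 1) (update ρ (outVar M i k) (code b)) fun w hw => by
      rw [update_of_ne (node_ne_outVar _ _ _ _)]
      exact h w (by simp [hw])
    refine ⟨ρ', code b, H.pos b b fun x => ?_, hρ'⟩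
    rw [conj_holds, link_holds, link_holds, update_self, update_of_ne (node_ne_outVar _ _ _ _), hb]
    exact fun h => ⟨h.1, h.1⟩

theorem exists_holds {ρ : ℕ → Fin (d + 2)} {δ : PropFormula (d + 2)}
    (h : 0 < 𝔐.probability ρ δ) : ∃ x : Fin n → Fin (d + 2), δ.Holds x ρ := by
  by_contra! hc
  simp [SCM.probability, hc] at h

/-- No assumption on the truth tables is needed: both links fix the same `X₀`, so the copy is exact
in every model. -/
theorem Path.outLayers_value (M : ℕ) (i : Fin 7) (us : List ℕ) :
    ∀ (k : ℕ) (ρ ρ' : ℕ → Fin (d + 2)), Path 𝔐 (outLayers M i k us) ρ ρ' →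
      ∀ t (ht : t < us.length), ρ' (outVar M i (k + t)) = ρ (node us[t]) := by
  induction us with
  | nil => intro k ρ ρ' _ t ht; simp at ht
  | cons u us ih =>
    rintro k ρ ρ' ⟨z, h1, h2⟩ t ht
    rcases t with _ | t
    · obtain ⟨x, hx⟩ := exists_holds h1
      rw [conj_holds, link_holds, link_holds, update_of_ne (node_ne_outVar _ _ _ _)] at hx
      obtain ⟨⟨_, e1⟩, _, e2⟩ := hx
      rw [h2.eq_of_notMem]
      · exact e1.symm.trans e2
      · intro l hl
        obtain ⟨k', hk', e⟩ := fst_outLayers _ _ _ _ l hl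
        rw [e, Ne, outVar, outVar]
        omega
    · have := ih _ _ _ h2 t (by simpa using ht)
      rw [update_of_ne (node_ne_outVar _ _ _ _)] at this
      rw [show k + (t + 1) = k + 1 + t by omega, this]
      rfl

theorem exists_path_circuitLayers (H : HasRows 𝔐) {M N : ℕ} (i : Fin 7) (C : Circuit M N)
    {j : Fin M → Bool} {ρ : ℕ → Fin (d + 2)} (hj : ∀ u : Fin M, ρ (node u) = code (j u)) :
    ∃ ρ', Path 𝔐 (circuitLayers i C) ρ ρ' ∧ ∀ k : Fin N, ρ' (outVar M i k) = code (C.eval j k) := by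
  obtain ⟨ρ₁, h1, h2⟩ := exists_path_gateLayers H C.gates j ρ hj
  obtain ⟨ρ', h3⟩ := exists_path_outLayers H M i (List.ofFn fun k => (C.out k : ℕ)) 0 ρ₁ <| by
    intro u hu
    obtain ⟨k, rfl⟩ := (List.mem_ofFn' _ _).mp hu
    exact ⟨_, h2 _⟩
  refine ⟨ρ', (path_append _ _ _ _ _).mpr ⟨ρ₁, h1, h3⟩, fun k => ?_⟩
  have := h3.outLayers_value _ _ _ _ _ _ k (by simp)
  simpa [h2, Circuit.eval] using this

theorem Path.circuitLayers_value (S : OnlyRows 𝔐) {M N : ℕ} (i : Fin 7) (C : Circuit M N)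
    {j : Fin M → Bool} {ρ ρ' : ℕ → Fin (d + 2)} (hj : ∀ u : Fin M, ρ (node u) = code (j u))
    (h : Path 𝔐 (circuitLayers i C) ρ ρ') (k : Fin N) :
    ρ' (outVar M i k) = code (C.eval j k) := by
  obtain ⟨ρ₁, h1, h3⟩ := (path_append _ _ _ _ _).mp h
  have h2 := Path.gateLayers_value S C.gates j ρ ρ₁ hj h1
  have := h3.outLayers_value _ _ _ _ _ _ k (by simp)
  simpa [h2, Circuit.eval] using this

/-- A circuit binds only nodes from `M` on and its outputs, so the next circuit still sees the same
input. -/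
theorem Path.circuitLayers_node {M N : ℕ} {i : Fin 7} {C : Circuit M N}
    {ρ ρ' : ℕ → Fin (d + 2)} (h : Path 𝔐 (circuitLayers i C) ρ ρ') (u : Fin M) :
    ρ' (node u) = ρ (node u) := by
  refine h.eq_of_notMem _ _ fun l hl => ?_
  rcases fst_circuitLayers _ _ l hl with ⟨w, hw, e⟩ | ⟨k, e⟩ <;> rw [e]
  · exact node_injective.ne (by omega)
  · exact (node_ne_outVar _ _ _ _).symm

theorem Path.circuitsLayers_outVar {I : SuccInstance} {is : List (Fin 7)}
    {ρ ρ' : ℕ → Fin (d + 2)} (h : Path 𝔐 (circuitsLayers I is) ρ ρ') (i : Fin 7) (hi : i ∉ is)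
    (k : ℕ) : ρ' (outVar I.M i k) = ρ (outVar I.M i k) := by
  refine h.eq_of_notMem _ _ fun l hl => ?_
  simp only [circuitsLayers, List.mem_flatten, List.mem_map] at hl
  obtain ⟨_, ⟨i', hi', rfl⟩, hl⟩ := hl
  rcases fst_circuitLayers _ _ l hl with ⟨w, hw, e⟩ | ⟨k', e⟩ <;> rw [e]
  · exact node_ne_outVar _ _ _ _
  · intro e'
    exact hi ((outVar_inj e').1 ▸ hi')

theorem exists_path_circuitsLayers (H : HasRows 𝔐) (I : SuccInstance) (j : Fin I.M → Bool)
    (is : List (Fin 7)) : ∀ ρ : ℕ → Fin (d + 2), (∀ u : Fin I.M, ρ (node u) = code (j u)) →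
      ∃ ρ', Path 𝔐 (circuitsLayers I is) ρ ρ' ∧
        ∀ i ∈ is, ∀ k : Fin I.N, ρ' (outVar I.M i k) = code ((I.C i).eval j k) := by
  induction is with
  | nil => exact fun ρ _ => ⟨ρ, rfl, by simp⟩
  | cons i is ih =>
    intro ρ hρ
    obtain ⟨ρ₁, h1, h2⟩ := exists_path_circuitLayers H i (I.C i) hρ
    obtain ⟨ρ', h3, h4⟩ := ih ρ₁ fun u => by rw [h1.circuitLayers_node, hρ]
    refine ⟨ρ', (path_append _ _ _ _ _).mpr ⟨ρ₁, h1, h3⟩, fun i' hi' k => ?_⟩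
    -- If the index occurs again, the later occurrence decides; otherwise its outputs survive the
    -- remaining layers.
    by_cases hm : i' ∈ is
    · exact h4 i' hm k
    · obtain rfl : i' = i := by simpa [hm] using hi'
      rw [Path.circuitsLayers_outVar h3 i' hm, h2]

theorem Path.circuitsLayers_value (S : OnlyRows 𝔐) (I : SuccInstance) (j : Fin I.M → Bool)
    (is : List (Fin 7)) : ∀ ρ ρ' : ℕ → Fin (d + 2), (∀ u : Fin I.M, ρ (node u) = code (j u)) →
      Path 𝔐 (circuitsLayers I is) ρ ρ' →
        ∀ i ∈ is, ∀ k : Fin I.N, ρ' (outVar I.M i k) = code ((I.C i).eval j k) := by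
  induction is with
  | nil => simp
  | cons i is ih =>
    intro ρ ρ' hρ h i' hi' k
    obtain ⟨ρ₁, h1, h3⟩ := (path_append _ _ _ _ _).mp h
    by_cases hm : i' ∈ is
    · exact ih ρ₁ ρ' (fun u => by rw [Path.circuitLayers_node h1, hρ]) h3 i' hm k
    · obtain rfl : i' = i := by simpa [hm] using hi'
      rw [Path.circuitsLayers_outVar h3 i' hm, Path.circuitLayers_value S _ _ hρ h1]

theorem fst_inputLayers {c : ℕ} (k : ℕ) : ∀ j : ℕ, ∀ l ∈ inputLayers (c := c) j k,
    ∃ u, j ≤ u ∧ l.1 = node u := by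
  induction k with
  | zero => simp [inputLayers]
  | succ k ih =>
    intro j l hl
    rcases List.mem_cons.mp hl with rfl | hl
    · exact ⟨j, le_rfl, rfl⟩
    · obtain ⟨u, hu, e⟩ := ih _ l hl
      exact ⟨u, by omega, e⟩

theorem Path.inputLayers_node {k j u : ℕ} (h : u < j) {ρ ρ' : ℕ → Fin (d + 2)}
    (hp : Path 𝔐 (inputLayers j k) ρ ρ') : ρ' (node u) = ρ (node u) := by
  refine hp.eq_of_notMem _ _ fun l hl => ?_
  obtain ⟨w, hw, e⟩ := fst_inputLayers _ _ l hl
  rw [e]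
  exact node_injective.ne (by omega)

theorem exists_path_inputLayers (H : HasRows 𝔐) (b : ℕ → Bool) (k : ℕ) :
    ∀ (j : ℕ) (ρ : ℕ → Fin (d + 2)), ∃ ρ', Path 𝔐 (inputLayers j k) ρ ρ' ∧
      ∀ u, j ≤ u → u < j + k → ρ' (node u) = code (b u) := by
  induction k with
  | zero => exact fun j ρ => ⟨ρ, rfl, by omega⟩
  | succ k ih =>
    intro j ρ
    obtain ⟨ρ', h1, h2⟩ := ih (j + 1) (update ρ (node j) (code (b j)))
    refine ⟨ρ', ⟨code (b j), H.pos (b j) (b j) fun x hx => ?_, h1⟩, fun u hu hu' => ?_⟩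
    · rw [link_holds, update_self]
      exact hx.1
    · rcases hu.eq_or_lt with rfl | hu
      · rw [Path.inputLayers_node (Nat.lt_succ_self _) h1, update_self]
      · exact h2 u hu (by omega)

/-- Values other than 0 and 1 have weight zero, because `X₀` is almost surely a bit. -/
theorem Path.inputLayers_value (S : OnlyRows 𝔐) (k : ℕ) :
    ∀ (j : ℕ) (ρ ρ' : ℕ → Fin (d + 2)), Path 𝔐 (inputLayers j k) ρ ρ' →
      ∀ u, j ≤ u → u < j + k → ∃ b, ρ' (node u) = code b := by
  induction k with
  | zero => intros; omega
  | succ k ih =>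
    rintro j ρ ρ' ⟨z, h1, h2⟩ u hu hu'
    rcases hu.eq_or_lt with rfl | hu
    · obtain ⟨x, a, b, ⟨⟨_, h⟩, -⟩, _, e⟩ := S _ _ h1
      refine ⟨a, ?_⟩
      rw [Path.inputLayers_node (Nat.lt_succ_self _) h2]
      exact e.symm.trans h
    · exact ih _ _ _ h2 u hu (by omega)

/-- No `j` is missed: this is the half that a model of the formula needs. -/
theorem exists_path_layers (H : HasRows 𝔐) (I : SuccInstance) (j : Fin I.M → Bool)
    (ρ : ℕ → Fin (d + 2)) : ∃ ρ', Path 𝔐 (layers I) ρ ρ' ∧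
      ∀ (i : Fin 7) (k : Fin I.N), ρ' (outVar I.M i k) = code ((I.C i).eval j k) := by
  obtain ⟨ρ₁, h1, h2⟩ := exists_path_inputLayers H
    (fun u => if h : u < I.M then j ⟨u, h⟩ else false) I.M 0 ρ
  obtain ⟨ρ', h3, h4⟩ := exists_path_circuitsLayers H I j (List.finRange 7) ρ₁ fun u => by
    simp [h2 u (Nat.zero_le _) (by omega)]
  exact ⟨ρ', (path_append _ _ _ _ _).mpr ⟨ρ₁, h1, h3⟩, fun i => h4 i (List.mem_finRange i)⟩

/-- No summand of positive weight is spurious: this is the half that the constructed model needs. -/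
theorem Path.layers_value (S : OnlyRows 𝔐) (I : SuccInstance) (ρ ρ' : ℕ → Fin (d + 2))
    (h : Path 𝔐 (layers I) ρ ρ') : ∃ j : Fin I.M → Bool,
      ∀ (i : Fin 7) (k : Fin I.N), ρ' (outVar I.M i k) = code ((I.C i).eval j k) := by
  obtain ⟨ρ₁, h1, h3⟩ := (path_append _ _ _ _ _).mp h
  choose j hj using fun u : Fin I.M =>
    Path.inputLayers_value S _ _ _ _ h1 u (Nat.zero_le _) (by omega)
  exact ⟨j, fun i => Path.circuitsLayers_value S I j _ _ _ hj h3 i (List.mem_finRange i)⟩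

end Circuits

/-! ## The values of the two sides -/

section Sides

variable {n d : ℕ} (𝔐 : SCM n (d + 2))

theorem falsum_holds {x : Fin n → Fin (d + 2)} {ρ : ℕ → Fin (d + 2)} : ¬ falsum.Holds x ρ := by
  rintro ⟨⟨_, h⟩, _, h'⟩
  simp [h, ValTerm.eval] at h'

theorem event_holds {M i : ℕ} {x : Fin n → Fin (d + 2)} {ρ : ℕ → Fin (d + 2)} : ∀ N : ℕ,
    (event M i N).Holds x ρ ↔ ∀ k < N, ∃ h : outVar M 7 k < n, x ⟨outVar M 7 k, h⟩ = ρ (outVar M i k)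
  | 0 => by
    simp only [Nat.not_lt_zero, false_implies, implies_true, iff_true]
    exact falsum_holds
  | N + 1 => by
    rw [event, conj_holds, event_holds N, link_holds]
    constructor
    · rintro ⟨h1, h2⟩ k hk
      rcases Nat.lt_succ_iff_lt_or_eq.mp hk with hk | rfl
      · exact h2 k hk
      · exact h1
    · exact fun h => ⟨h N (by omega), fun k hk => h k (by omega)⟩

/-- The event that the random variables `E_k` encode `e`. -/
def outputEvent (M N : ℕ) (e : Fin N → Bool) (x : Fin n → Fin (d + 2)) : Prop :=
  ∀ k : Fin N, ∃ h : outVar M 7 k < n, x ⟨outVar M 7 k, h⟩ = code (e k)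

theorem event_holds_iff {M N i : ℕ} {e : Fin N → Bool} {ρ : ℕ → Fin (d + 2)}
    (h : ∀ k : Fin N, ρ (outVar M i k) = code (e k)) {x : Fin n → Fin (d + 2)} :
    (event M i N).Holds x ρ ↔ outputEvent M N e x := by
  rw [event_holds]
  constructor
  · intro H k
    rw [← h k]
    exact H k k.2
  · intro H k hk
    have := h ⟨k, hk⟩
    rw [show ρ (outVar M i k) = code (e ⟨k, hk⟩) from this]
    exact H ⟨k, hk⟩

/-- The conditional probability that represents the real variable `x_e`. -/
noncomputable def condProb (M N : ℕ) (e : Fin N → Bool) : ℝ :=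
  (𝔐.P {u | (∃ h : 5 < n, 𝔐.value u ⟨5, h⟩ = 0) ∧ outputEvent M N e (𝔐.value u)}).toReal /
    (𝔐.P {u | outputEvent M N e (𝔐.value u)}).toReal

theorem var_eval {M N : ℕ} {i : Fin 7} {e : Fin N → Bool} {ρ : ℕ → Fin (d + 2)}
    (h : ∀ k : Fin N, ρ (outVar M i k) = code (e k)) :
    ((NatPoly.var i).toTerm M N).eval 𝔐 ρ = condProb 𝔐 M N e := by
  simp only [NatPoly.toTerm, ProbTerm.eval, SCM.probability, conj_holds, event_holds_iff h]
  rfl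

theorem falsum_probability (ρ : ℕ → Fin (d + 2)) : 𝔐.probability ρ falsum = 0 := by
  simp [SCM.probability, falsum_holds]

theorem verum_probability (ρ : ℕ → Fin (d + 2)) : 𝔐.probability ρ (.neg falsum) = 1 := by
  have := 𝔐.isProbabilityMeasure
  have h : ∀ x : Fin n → Fin (d + 2), (PropFormula.neg falsum).Holds x ρ := fun _ => falsum_holds
  simp [SCM.probability, h]

theorem toTerm_eval (M N : ℕ) (ρ : ℕ → Fin (d + 2)) (p : NatPoly) :
    (p.toTerm M N).eval 𝔐 ρ = p.value fun i => ((NatPoly.var i).toTerm M N).eval 𝔐 ρ := by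
  induction p with
  | one => exact verum_probability 𝔐 ρ
  | var i => rfl
  | add p q hp hq => simp only [NatPoly.value, ← hp, ← hq]; rfl
  | mul p q hp hq => simp only [NatPoly.value, ← hp, ← hq]; rfl

/-- This includes conditions of probability zero, where the quotient is 0. -/
theorem cond_mem_Icc (ρ : ℕ → Fin (d + 2)) (δ δ' : PropFormula (d + 2)) :
    (ProbTerm.cond δ δ').eval 𝔐 ρ ∈ Set.Icc (0 : ℝ) 1 :=
  ⟨div_nonneg (probability_nonneg _ _ _) (probability_nonneg _ _ _),
    div_le_one_of_le₀ (probability_mono 𝔐 fun _ h => h.2) (probability_nonneg _ _ _)⟩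

theorem condProb_mem_Icc (M N : ℕ) (e : Fin N → Bool) : condProb 𝔐 M N e ∈ Set.Icc (0 : ℝ) 1 := by
  have := 𝔐.isProbabilityMeasure
  exact ⟨div_nonneg ENNReal.toReal_nonneg ENNReal.toReal_nonneg,
    div_le_one_of_le₀ (ENNReal.toReal_mono (MeasureTheory.measure_ne_top _ _)
      (MeasureTheory.measure_mono fun u hu => hu.2)) ENNReal.toReal_nonneg⟩

/-- The difference is `1 - q₀` plus two squares, and a conditional probability is at most 1. Hence
the inequality in the formula can hold only as an equality. -/
theorem right_le_left (M N : ℕ) (ρ : ℕ → Fin (d + 2)) :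
    ((side false).toTerm M N).eval 𝔐 ρ ≤ ((side true).toTerm M N).eval 𝔐 ρ := by
  rw [toTerm_eval, toTerm_eval _ _ _ _ (side true), ← sub_nonneg, side_value]
  have := (cond_mem_Icc 𝔐 ρ (.eq 5 (.const 0)) (event M (0 : Fin 7) N)).2
  exact add_nonneg (add_nonneg (sub_nonneg.mpr this) (sq_nonneg _)) (sq_nonneg _)

theorem tableProduct_pos_iff (ρ : ℕ → Fin (d + 2)) :
    ¬ tableProduct.eval 𝔐 ρ ≤ (ProbTerm.prob falsum).eval 𝔐 ρ ↔
      ∀ a b, 0 < 𝔐.probability ρ (tableRow a b) := by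
  simp only [tableProduct, ProbTerm.eval, falsum_probability, not_le]
  have h := fun a b => probability_nonneg 𝔐 ρ (tableRow a b)
  constructor
  · intro hp a b
    refine (h a b).lt_of_ne fun h0 => hp.ne' ?_
    cases a <;> cases b <;> simp [← h0]
  · intro H
    exact mul_pos (mul_pos (H _ _) (H _ _)) (mul_pos (H _ _) (H _ _))

/-- Table rows contain no summation variables, so a single `ρ` is enough. -/
theorem hasRows_iff (ρ : ℕ → Fin (d + 2)) :
    HasRows 𝔐 ↔ ∀ a b, 0 < 𝔐.probability ρ (tableRow a b) :=
  ⟨fun h => h ρ, fun h _ a b => h a b⟩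

end Sides

/-- The equations for the conditional probabilities `4 x + 1/2`. -/
theorem equations_iff (x : Fin 7 → ℝ) :
    (x 0 = 1 / 8 ∧ x 1 + x 2 = x 3 ∧ x 4 * x 5 = x 6) ↔
      (4 * x 0 + 1 / 2 = 1 ∧
        2 * (4 * x 1 + 1 / 2) + 2 * (4 * x 2 + 1 / 2) - (2 * (4 * x 3 + 1 / 2) + 1) = 0 ∧
        4 * ((4 * x 4 + 1 / 2) * (4 * x 5 + 1 / 2)) + 9 -
          (16 * (4 * x 6 + 1 / 2) + 2 * ((4 * x 4 + 1 / 2) + (4 * x 5 + 1 / 2))) = 0) := by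
  refine and_congr ?_ (and_congr ?_ ?_) <;> constructor <;> intro h <;> linarith

/-! ## From a model to a solution -/

theorem mem_succETR_of_models {n d : ℕ} {I : SuccInstance} {𝔐 : SCM n (d + 2)}
    (h : 𝔐.Models (formula d I)) : I ∈ SuccETR (1 / 8) (-(1 / 8)) (1 / 8) := by
  obtain ⟨h1, h2⟩ := h 0
  have H : HasRows 𝔐 := (hasRows_iff 𝔐 0).mpr ((tableProduct_pos_iff 𝔐 0).mp h1)
  -- The inverse of `x ↦ 4 x + 1/2`. An index of probability zero gets the value `-1/8`, which is
  -- still in range.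
  refine ⟨fun e => (condProb 𝔐 I.M I.N e - 1 / 2) / 4, fun e => ?_, fun j => ?_⟩
  · have := condProb_mem_Icc 𝔐 I.M I.N e
    constructor <;> linarith [this.1, this.2]
  · obtain ⟨ρ, hp, hρ⟩ := exists_path_layers H I j 0
    have hle := le_of_weighted_le 𝔐 (right_le_left 𝔐 I.M I.N) _ _ h2 _ hp
    rw [toTerm_eval, toTerm_eval _ _ _ _ (side false), ← sub_nonpos, side_value] at hle
    simp only [fun i => var_eval 𝔐 (hρ i)] at hle
    have h0 := (condProb_mem_Icc 𝔐 I.M I.N ((I.C 0).eval j)).2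
    set q := fun i => condProb 𝔐 I.M I.N ((I.C i).eval j) with hq
    have e : ∀ i, 4 * ((q i - 1 / 2) / 4) + 1 / 2 = q i := fun i => by ring
    refine (equations_iff fun i => (q i - 1 / 2) / 4).mpr ?_
    simp only [e]
    have s1 := sq_nonneg (2 * q 1 + 2 * q 2 - (2 * q 3 + 1))
    have s2 := sq_nonneg (4 * (q 4 * q 5) + 9 - (16 * q 6 + 2 * (q 4 + q 5)))
    -- `hle` bounds a sum of three nonnegative terms by 0, so each of them vanishes.
    refine ⟨?_, ?_, ?_⟩
    · exact le_antisymm h0 (by linarith)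
    · exact pow_eq_zero_iff two_ne_zero |>.mp (le_antisymm (by linarith) s1)
    · exact pow_eq_zero_iff two_ne_zero |>.mp (le_antisymm (by linarith) s2)

/-! ## From a solution to a model -/

section Model

/-- The sample space: two inputs of a gate, an output of a circuit, and a biased bit. -/
abbrev Sample (N : ℕ) : Type := (Bool × Bool) × (Fin N → Bool) × Bool

open Classical in
noncomputable def sampleValue {d N : ℕ} (M : ℕ) (ω : Sample N) (X : ℕ) : Fin (d + 2) :=
  if X = 0 then code ω.1.1
  else if X = 1 then code ω.1.2
  else if X = 2 then code !ω.1.1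
  else if X = 3 then code (ω.1.1 && ω.1.2)
  else if X = 4 then code (ω.1.1 || ω.1.2)
  else if X = 5 then code ω.2.2
  else if h : ∃ k : Fin N, outVar M 7 k = X then code (ω.2.1 h.choose) else 0

theorem sampleValue_outVar {d N : ℕ} (M : ℕ) (ω : Sample N) (k : Fin N) :
    sampleValue (d := d) M ω (outVar M 7 k) = code (ω.2.1 k) := by
  have h : ∃ k' : Fin N, outVar M 7 k' = outVar M 7 k := ⟨k, rfl⟩
  have e : h.choose = k := Fin.ext (by
    have : 8 * (M + h.choose.val) + 7 = 8 * (M + k.val) + 7 := h.choose_spec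
    omega)
  have h7 : 7 ≤ outVar M 7 k := by simp only [outVar]; omega
  rw [sampleValue, if_neg (by omega), if_neg (by omega), if_neg (by omega), if_neg (by omega),
    if_neg (by omega), if_neg (by omega), dif_pos h, e]

/-- The bit is `0` with probability `q e` if the output is `e`, everything else is uniform. -/
noncomputable def sampleWeight {N : ℕ} (q : (Fin N → Bool) → ℝ) (ω : Sample N) : ℝ :=
  (4 * 2 ^ N)⁻¹ * if ω.2.2 then 1 - q ω.2.1 else q ω.2.1

variable {N : ℕ} {q : (Fin N → Bool) → ℝ}

theorem sampleWeight_nonneg (hq : ∀ e, q e ∈ Set.Icc (0 : ℝ) 1) (ω : Sample N) :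
    0 ≤ sampleWeight q ω := by
  refine mul_nonneg (by positivity) ?_
  split_ifs
  · linarith [(hq ω.2.1).2]
  · exact (hq ω.2.1).1

/-- The condition ignores the two table bits; summing over them absorbs the factor 4. -/
theorem sum_sampleWeight_ite (P : (Fin N → Bool) → Bool → Prop) [∀ e b, Decidable (P e b)] :
    (∑ ω : Sample N, if P ω.2.1 ω.2.2 then sampleWeight q ω else 0) =
      (2 ^ N)⁻¹ * ∑ e, ((if P e true then 1 - q e else 0) + if P e false then q e else 0) := by
  simp only [Fintype.sum_prod_type, sampleWeight, Fintype.sum_bool, Finset.mul_sum]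
  simp only [← Finset.sum_add_distrib]
  refine Finset.sum_congr rfl fun e _ => ?_
  by_cases h1 : P e true <;> by_cases h2 : P e false <;> simp [h1, h2] <;> field_simp <;> ring

theorem sum_sampleWeight : ∑ ω : Sample N, sampleWeight q ω = 1 := by
  have := sum_sampleWeight_ite (q := q) fun _ _ => True
  simp at this
  rw [this]

open MeasureTheory

instance (N : ℕ) : MeasurableSpace (Sample N) := ⊤

noncomputable def sampleMeasure (q : (Fin N → Bool) → ℝ) : Measure (Unit → Sample N) :=
  ∑ ω : Sample N, ENNReal.ofReal (sampleWeight q ω) • Measure.dirac fun _ => ω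

open Classical in
theorem sampleMeasure_toReal (hq : ∀ e, q e ∈ Set.Icc (0 : ℝ) 1) (S : Set (Unit → Sample N)) :
    (sampleMeasure q S).toReal =
      ∑ ω : Sample N, if (fun _ => ω) ∈ S then sampleWeight q ω else 0 := by
  -- With measurable singletons, Dirac measures can be evaluated on arbitrary sets.
  have : MeasurableSingletonClass (Sample N) := ⟨fun _ => MeasurableSpace.measurableSet_top⟩
  rw [sampleMeasure, Measure.finsetSum_apply, ENNReal.toReal_sum]
  · refine Finset.sum_congr rfl fun ω _ => ?_
    by_cases h : (fun _ => ω) ∈ S <;>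
      simp [h, sampleWeight_nonneg hq]
  · intro ω _
    by_cases h : (fun _ => ω) ∈ S <;> simp [h]

theorem isProbabilityMeasure_sampleMeasure (hq : ∀ e, q e ∈ Set.Icc (0 : ℝ) 1) :
    IsProbabilityMeasure (sampleMeasure q) := by
  have h := sampleMeasure_toReal hq Set.univ
  simp only [Set.mem_univ, if_true, sum_sampleWeight] at h
  exact ⟨by rw [← ENNReal.ofReal_toReal (a := sampleMeasure q Set.univ) (fun e => by simp [e] at h), h,
    ENNReal.ofReal_one]⟩

/-- All randomness sits in one exogenous variable, and no endogenous variable depends on its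
predecessors. -/
noncomputable def sampleModel (d M n : ℕ) (hq : ∀ e, q e ∈ Set.Icc (0 : ℝ) 1) : SCM n (d + 2) where
  Exo := Unit
  Dom _ := Sample N
  measurableSpace _ := inferInstance
  P := sampleMeasure q
  isProbabilityMeasure := isProbabilityMeasure_sampleMeasure hq
  F i _ u := sampleValue M (u ()) i
  measurable_F i _ :=
    (measurable_from_top (f := fun ω : Sample N => sampleValue M ω i)).comp (measurable_pi_apply ())

variable (hq : ∀ e, q e ∈ Set.Icc (0 : ℝ) 1) {d M n : ℕ}

/-- The values of the random variables at a point of the sample space. -/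
noncomputable def sampleVector (d M n : ℕ) (ω : Sample N) : Fin n → Fin (d + 2) :=
  fun i => sampleValue M ω i

theorem value_eq {n c : ℕ} (𝔐 : SCM n c) (u : ∀ k, 𝔐.Dom k) (i : Fin n) :
    𝔐.value u i = 𝔐.F i (fun j => 𝔐.value u ⟨j, j.isLt.trans i.isLt⟩) u := by
  rw [SCM.value]

open Classical in
theorem sampleModel_measure (A : (Fin n → Fin (d + 2)) → Prop) :
    ((sampleModel d M n hq).P {u | A ((sampleModel d M n hq).value u)}).toReal =
      ∑ ω : Sample N, if A (sampleVector d M n ω) then sampleWeight q ω else 0 := by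
  have e : (sampleModel d M n hq).value = fun u => sampleVector d M n (u ()) :=
    funext fun u => funext fun i => value_eq _ u i
  rw [e]
  exact sampleMeasure_toReal hq {u | A (sampleVector d M n (u ()))}

theorem sampleVector_tableRow (hn : 6 ≤ n) (ω : Sample N) (ρ : ℕ → Fin (d + 2)) :
    (tableRow ω.1.1 ω.1.2).Holds (sampleVector d M n ω) ρ :=
  tableRow_holds.mpr ⟨⟨by omega, rfl⟩, ⟨by omega, rfl⟩, ⟨by omega, rfl⟩, ⟨by omega, rfl⟩,
    ⟨by omega, rfl⟩⟩

theorem sampleModel_onlyRows (hn : 6 ≤ n) : OnlyRows (sampleModel d M n hq) := by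
  classical
  intro ρ δ h
  rw [SCM.probability, sampleModel_measure hq fun x => δ.Holds x ρ] at h
  obtain ⟨ω, -, hω⟩ := Finset.exists_ne_zero_of_sum_ne_zero h.ne'
  exact ⟨_, _, _, sampleVector_tableRow hn ω ρ, of_not_not fun hc => hω (if_neg hc)⟩

theorem sampleModel_hasRows (hn : 6 ≤ n) : HasRows (sampleModel d M n hq) := by
  classical
  intro ρ a b
  rw [SCM.probability, sampleModel_measure hq fun x => (tableRow a b).Holds x ρ]
  -- `q` and `1 - q` are not both zero, so some value of the biased bit has positive weight. The
  -- output index is arbitrary.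
  obtain ⟨z, hz⟩ : ∃ z : Bool, 0 < if z then 1 - q (fun _ => false) else q fun _ => false := by
    rcases (hq fun _ => false).1.eq_or_lt with h | h
    · exact ⟨true, by simp [← h]⟩
    · exact ⟨false, by simpa using h⟩
  refine Finset.sum_pos' (fun ω _ => ?_) ⟨((a, b), (fun _ => false), z), Finset.mem_univ _, ?_⟩
  · split_ifs
    · exact sampleWeight_nonneg hq ω
    · exact le_rfl
  · rw [if_pos (sampleVector_tableRow hn ((a, b), (fun _ : Fin N => false), z) ρ)]
    exact mul_pos (by positivity) hz

theorem sampleVector_outputEvent (hn : outVar M 7 N ≤ n) (e : Fin N → Bool) (ω : Sample N) :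
    outputEvent M N e (sampleVector d M n ω) ↔ ω.2.1 = e := by
  have hlt : ∀ k : Fin N, outVar M 7 k < n := fun k => by
    have := k.2; simp only [outVar] at hn ⊢; omega
  simp only [outputEvent, sampleVector, sampleValue_outVar, exists_prop, hlt, true_and,
    code_injective.eq_iff]
  exact funext_iff.symm

theorem sampleVector_bit (hn : 6 ≤ n) (ω : Sample N) :
    (∃ h : 5 < n, sampleVector d M n ω ⟨5, h⟩ = 0) ↔ ω.2.2 = false := by
  rw [exists_prop_of_true (by omega)]
  simp only [sampleVector, sampleValue]
  cases ω.2.2 <;> simp [code]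

/-- The index `e` has probability `2⁻ᴺ`, and together with `X₅ = 0` probability `2⁻ᴺ * q e`. -/
theorem sampleModel_condProb (hn : outVar M 7 N ≤ n) (e : Fin N → Bool) :
    condProb (sampleModel d M n hq) M N e = q e := by
  classical
  have h6 : 6 ≤ n := by simp only [outVar] at hn; omega
  have h1 := sampleModel_measure (d := d) (M := M) (n := n) hq (outputEvent M N e)
  have h2 := sampleModel_measure (d := d) (M := M) (n := n) hq
    fun x => (∃ h : 5 < n, x ⟨5, h⟩ = 0) ∧ outputEvent M N e x
  simp only [sampleVector_outputEvent hn, sampleVector_bit h6] at h1 h2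
  rw [sum_sampleWeight_ite fun e' _ => e' = e] at h1
  rw [sum_sampleWeight_ite fun e' b => b = false ∧ e' = e] at h2
  simp only [reduceCtorEq, false_and, if_false, zero_add, true_and, Finset.sum_add_distrib,
    Finset.sum_ite_eq', Finset.mem_univ, if_true] at h1 h2
  rw [condProb, h1, h2]
  field_simp
  ring

end Model

theorem formula_mem_satProb {d : ℕ} {I : SuccInstance}
    (h : I ∈ SuccETR (1 / 8) (-(1 / 8)) (1 / 8)) : formula d I ∈ SatProb (d + 2) := by
  obtain ⟨x, hx, hj⟩ := h
  have hq : ∀ e, 4 * x e + 1 / 2 ∈ Set.Icc (0 : ℝ) 1 := fun e => by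
    have := hx e
    constructor <;> linarith [this.1, this.2]
  -- The index that would follow the last `E_k`; it also exceeds those of `X₀, …, X₅`.
  set n := outVar I.M 7 I.N with hn
  have h7 : 7 ≤ n := by simp only [hn, outVar]; omega
  refine ⟨formula_closed I, n, formula_varsBelow (by omega) I fun k hk => ?_,
    sampleModel d I.M n hq, fun ρ => ⟨?_, ?_⟩⟩
  · simp only [hn, outVar]; omega
  · exact (tableProduct_pos_iff _ ρ).mpr (sampleModel_hasRows hq (by omega) ρ)
  · refine weighted_le _ _ _ fun ρ' hρ' => ?_
    -- Positive weight means that the circuits are evaluated at some `j`, where the equations make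
    -- the sides equal.
    obtain ⟨j, hj'⟩ := Path.layers_value (sampleModel_onlyRows hq (by omega)) I ρ ρ' hρ'
    rw [toTerm_eval, toTerm_eval _ _ _ _ (side false), ← sub_nonpos, side_value]
    simp only [fun i => var_eval (sampleModel d I.M n hq) (hj' i), fun i =>
      sampleModel_condProb (d := d) hq hn.ge ((I.C i).eval j)]
    obtain ⟨e1, e2, e3⟩ := (equations_iff fun i => x ((I.C i).eval j)).mp (hj j)
    rw [e1, e2, e3]
    norm_num

theorem mem_succETR_iff (d : ℕ) (I : SuccInstance) :
    I ∈ SuccETR (1 / 8) (-(1 / 8)) (1 / 8) ↔ formula d I ∈ SatProb (d + 2) :=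
  ⟨formula_mem_satProb, fun ⟨_, _, _, _, h⟩ => mem_succETR_of_models h⟩

/-! ## The machine: an interpreter for a stack of instructions -/

/-- The counter holds a mark for each node numbered so far: `true` for inputs, `false` for gates or
outputs. `walk` writes a name `8 * count + r` and `back` restores the counter; `mark` adds a mark,
and `reset` removes the `false` ones. `num` turns a node number of the input into the name of its
summation variable. -/
inductive Instr : Type
  | sym (a : FSym)
  | walk (r : Fin 8)
  | back
  | mark (b : Bool)
  | reset
  | num
  | inputs
  | skip
  | gates
  | outs (i : Fin 7)
  | event (i : Fin 7)
  | unstash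
  | clear
  | rewind
  | drain
  | flip
  deriving DecidableEq, Fintype

/-- The stacks: instructions, unread and read input, a counter with two places to put parts of it
aside, the output in reverse, and the output. -/
inductive Stk : Type
  | work | inp | read | cnt | tmp | stash | acc | out
  deriving DecidableEq

instance : Fintype Stk where
  elems := {.work, .inp, .read, .cnt, .tmp, .stash, .acc, .out}
  complete k := by cases k <;> simp

abbrev Stk.Sym : Stk → Type
  | .work => Instr
  | .inp | .read => CSym
  | .cnt | .tmp | .stash => Bool
  | .acc | .out => FSym

instance : ∀ k : Stk, Fintype k.Sym
  | .work => inferInstanceAs (Fintype Instr)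
  | .inp | .read => inferInstanceAs (Fintype CSym)
  | .cnt | .tmp | .stash => inferInstanceAs (Fintype Bool)
  | .acc | .out => inferInstanceAs (Fintype FSym)

/-- The contents of the register of the machine. -/
abbrev Register : Type := Option (Instr ⊕ CSym ⊕ Bool ⊕ FSym)

def Stk.toRegister : (k : Stk) → Option k.Sym → Register
  | .work, o => o.map fun a : Instr => .inl a
  | .inp, o | .read, o => o.map fun a : CSym => .inr (.inl a)
  | .cnt, o | .tmp, o | .stash, o => o.map fun a : Bool => .inr (.inr (.inl a))
  | .acc, o | .out, o => o.map fun a : FSym => .inr (.inr (.inr a))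

theorem Stk.toRegister_injective : ∀ k : Stk, Injective k.toRegister
  | .work => Option.map_injective Sum.inl_injective
  | .inp | .read => Option.map_injective (Sum.inr_injective.comp Sum.inl_injective)
  | .cnt | .tmp | .stash =>
    Option.map_injective (Sum.inr_injective.comp (Sum.inr_injective.comp Sum.inl_injective))
  | .acc | .out =>
    Option.map_injective (Sum.inr_injective.comp (Sum.inr_injective.comp Sum.inr_injective))

/-- The symbols that one instruction pushes. -/
structure Pushes : Type where
  work : List Instr := []
  inp : List CSym := []
  read : List CSym := []
  cnt : List Bool := []
  tmp : List Bool := []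
  stash : List Bool := []
  acc : List FSym := []
  out : List FSym := []

inductive Action : Type
  | push (p : Pushes)
  | pop (k : Stk) (q : Option k.Sym → Pushes)

def syms (l : List FSym) : List Instr := l.map .sym

/-- Write the event that `X` has the value of the summation variable written by `l`. -/
def linkProg (X : ℕ) (l : List Instr) : List Instr :=
  syms (.eq :: (FSym.num X ++ [.dummy])) ++ l

def layerProg (y δ : List Instr) : List Instr :=
  .sym .sum :: (y ++ (.sym .mul :: .sym .prob :: δ))

def binaryProg (X : ℕ) : List Instr :=
  layerProg [.walk 7] (.sym .conj :: (linkProg X [.walk 7] ++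
    (.sym .conj :: (linkProg 0 [.num] ++ linkProg 1 [.num]))))

/-- `¬ (X₀ = 0 ∧ X₀ = 1)`. -/
def verumSyms : List FSym := (PropFormula.neg (falsum (d := 0))).encode

def Instr.action : Instr → Action
  | .sym a => .push { acc := [a] }
  | .walk r => .pop .cnt fun
    | some (b : Bool) => { tmp := [b], acc := List.replicate 8 .one, work := [.walk r] }
    | none => { acc := FSym.num r, work := [.back] }
  | .back => .pop .tmp fun
    | some (b : Bool) => { cnt := [b], work := [.back] }
    | none => {}
  | .mark b => .push { cnt := [b] }
  | .reset => .pop .cnt fun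
    | some false => { work := [.reset] }
    | some true => { cnt := [true] }
    | none => {}
  | .num => .pop .inp fun
    -- Eight strokes for each stroke read, and seven at the end, in accordance with `node u = 8 * u
    -- + 7`.
    | some CSym.one => { read := [.one], acc := List.replicate 8 .one, work := [.num] }
    | some CSym.sep => { read := [.sep], acc := FSym.num 7 }
    | _ => {}
  | .inputs => .pop .inp fun
    | some CSym.one => {
        read := [.one],
        work := layerProg [.walk 7] (linkProg 0 [.walk 7]) ++ [.mark true, .inputs] }
    | some CSym.sep => { read := [.sep] }
    | _ => {}
  | .skip => .pop .inp fun
    | some CSym.one => { read := [.one], work := [.skip] }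
    | some CSym.sep => { read := [.sep] }
    | _ => {}
  | .gates => .pop .inp fun
    | some CSym.neg => {
        read := [.neg],
        work := layerProg [.walk 7] (.sym .conj :: (linkProg 2 [.walk 7] ++ linkProg 0 [.num])) ++
          [.mark false, .gates] }
    | some CSym.conj => { read := [.conj], work := binaryProg 3 ++ [.mark false, .gates] }
    | some CSym.disj => { read := [.disj], work := binaryProg 4 ++ [.mark false, .gates] }
    | some CSym.out => { read := [.out] }
    | _ => {}
  | .outs i => .pop .inp fun
    | some CSym.done => { read := [.done] }
    -- The symbol begins the number of an output node; it is put back for `num` to read.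
    | some a => {
        inp := [a],
        work := layerProg [.walk i.castSucc]
            (.sym .conj :: (linkProg 0 [.walk i.castSucc] ++ linkProg 0 [.num])) ++
          [.mark false, .outs i] }
    | none => {}
  | .event i => .pop .cnt fun
    -- Taking the mark away first makes the counter show `M + k` for the output `k` being written,
    -- from `N - 1` down to 0.
    | some false => {
        stash := [false],
        work := .sym .conj :: .sym .eq :: .walk 7 :: .sym .dummy :: .walk i.castSucc ::
          [.event i] }
    | some true => { cnt := [true], work := syms verumSyms ++ [.unstash] }
    | none => { work := syms verumSyms ++ [.unstash] }
  | .unstash => .pop .stash fun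
    | some (b : Bool) => { cnt := [b], work := [.unstash] }
    | none => {}
  | .clear => .pop .cnt fun
    | some _ => { work := [.clear] }
    | none => {}
  | .rewind => .pop .read fun
    | some (a : CSym) => { inp := [a], work := [.rewind] }
    | none => {}
  | .drain => .pop .inp fun
    | some _ => { work := [.drain] }
    | none => {}
  | .flip => .pop .acc fun
    | some (a : FSym) => { out := [a], work := [.flip] }
    | none => {}

/-- Write a polynomial in the seven conditional probabilities. -/
def NatPoly.prog : NatPoly → List Instr
  | .one => syms (.prob :: verumSyms)
  | .var i => syms (.cond :: .eq :: (FSym.num 5 ++ .const :: FSym.num 0)) ++ [.event i]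
  | .add p q => .sym .add :: (p.prog ++ q.prog)
  | .mul p q => .sym .mul :: (p.prog ++ q.prog)

/-- The first `reset` discards the output marks of the previous circuit, the second the gate marks,
so that both gates and outputs are counted from `M`. -/
def circuitProg (i : Fin 7) : List Instr := [.reset, .gates, .reset, .outs i]

def sideProg (left : Bool) : List Instr :=
  -- `N` is skipped: after the last circuit the counter holds exactly `N` output marks, which is
  -- what the events need.
  [.inputs, .skip] ++ ((List.finRange 7).flatMap circuitProg ++ (side left).prog)

def constantSyms : List FSym :=
  .conj :: .neg :: .le :: ((tableProduct (d := 0)).encode ++ .prob :: (falsum (d := 0)).encode) ++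
    [.le]

/-- Each side reads the input anew, hence `rewind`. At the end `drain` empties the input and `flip`
moves the reversed output, because all stacks other than the output must be empty on halting. -/
def program : List Instr :=
  syms constantSyms ++ (sideProg true ++ ([.clear, .rewind] ++
    (sideProg false ++ [.clear, .rewind, .drain, .flip])))

inductive Label : Type
  | start | main
  deriving DecidableEq

instance : Fintype Label where
  elems := {.start, .main}
  complete l := by cases l <;> simp

abbrev MStmt : Type := TM2.Stmt Stk.Sym Label Register

def pushAll (k : Stk) (l : List k.Sym) (q : MStmt) : MStmt :=
  l.foldr (fun a q => .push k (fun _ => a) q) q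

def Pushes.stmt (p : Pushes) : MStmt :=
  pushAll .work p.work.reverse <| pushAll .inp p.inp.reverse <| pushAll .read p.read.reverse <|
    pushAll .cnt p.cnt.reverse <| pushAll .tmp p.tmp.reverse <| pushAll .stash p.stash.reverse <|
    pushAll .acc p.acc <| pushAll .out p.out.reverse <|
    .load (fun _ => none) <| .goto fun _ => .main

/-- Continue with the statement for the symbol in the register. -/
def select (k : Stk) (q : Option k.Sym → MStmt) : List (Option k.Sym) → MStmt
  | [] => .halt
  | o :: l => .branch (fun v => decide (v = k.toRegister o)) (q o) (select k q l)

noncomputable def popThen (k : Stk) (q : Option k.Sym → MStmt) : MStmt :=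
  .pop k (fun _ o => k.toRegister o) (select k q Finset.univ.toList)

noncomputable def Instr.stmt (i : Instr) : MStmt :=
  match i.action with
  | .push p => p.stmt
  | .pop k q => popThen k fun o => (q o).stmt

noncomputable def machineStmt : Label → MStmt
  | .start => Pushes.stmt { work := program }
  | .main => popThen .work fun
    | some (i : Instr) => i.stmt
    | none => .load (fun _ => none) .halt

noncomputable def machine : FinTM2 where
  K := Stk
  k₀ := .inp
  k₁ := .out
  Γ := Stk.Sym
  Λ := Label
  main := .start
  σ := Register
  initialState := none
  m := machineStmt

/-! ## One step of the machine -/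

/-- The contents of all stacks. -/
structure Store : Type where
  work : List Instr
  inp : List CSym
  read : List CSym
  cnt : List Bool
  tmp : List Bool
  stash : List Bool
  acc : List FSym
  out : List FSym

def Store.stk (s : Store) : (k : Stk) → List k.Sym
  | .work => s.work
  | .inp => s.inp
  | .read => s.read
  | .cnt => s.cnt
  | .tmp => s.tmp
  | .stash => s.stash
  | .acc => s.acc
  | .out => s.out

def Store.push (s : Store) (p : Pushes) : Store :=
  ⟨p.work ++ s.work, p.inp ++ s.inp, p.read ++ s.read, p.cnt ++ s.cnt, p.tmp ++ s.tmp,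
    p.stash ++ s.stash, p.acc.reverse ++ s.acc, p.out ++ s.out⟩

def Store.pop (s : Store) : Stk → Store
  | .work => { s with work := s.work.tail }
  | .inp => { s with inp := s.inp.tail }
  | .read => { s with read := s.read.tail }
  | .cnt => { s with cnt := s.cnt.tail }
  | .tmp => { s with tmp := s.tmp.tail }
  | .stash => { s with stash := s.stash.tail }
  | .acc => { s with acc := s.acc.tail }
  | .out => { s with out := s.out.tail }

def Store.run (s : Store) (i : Instr) : Store :=
  match i.action with
  | .push p => s.push p
  | .pop k q => (s.pop k).push (q (s.stk k).head?)

def Store.cfg (s : Store) : TM2.Cfg Stk.Sym Label Register := ⟨some .main, none, s.stk⟩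

theorem Store.stk_pop (s : Store) (k : Stk) :
    update s.stk k (s.stk k).tail = (s.pop k).stk := by
  funext k'
  cases k <;> cases k' <;> rfl

theorem stepAux_pushAll (k : Stk) (l : List k.Sym) (q : MStmt) : ∀ (v : Register)
    (S : ∀ k : Stk, List k.Sym),
    TM2.stepAux (pushAll k l q) v S = TM2.stepAux q v (update S k (l.reverse ++ S k)) := by
  induction l with
  | nil => intro v S; simp [pushAll]
  | cons a l ih =>
    intro v S
    rw [pushAll, List.foldr_cons, TM2.stepAux]
    refine (ih _ _).trans ?_
    simp

theorem stepAux_pushes (p : Pushes) (v : Register) (s : Store) :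
    TM2.stepAux p.stmt v s.stk = (s.push p).cfg := by
  simp only [Pushes.stmt, stepAux_pushAll, TM2.stepAux]
  refine congrArg (TM2.Cfg.mk (some Label.main) none) (funext fun k => ?_)
  cases k <;> simp [Store.push, Store.stk]

theorem stepAux_select (k : Stk) (q : Option k.Sym → MStmt) (o : Option k.Sym)
    (S : ∀ k : Stk, List k.Sym) (l : List (Option k.Sym)) (h : o ∈ l) :
    TM2.stepAux (select k q l) (k.toRegister o) S = TM2.stepAux (q o) (k.toRegister o) S := by
  induction l with
  | nil => simp at h
  | cons a l ih =>
    rw [select, TM2.stepAux]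
    by_cases e : o = a
    · simp [e]
    · rw [decide_eq_false fun e' => e (k.toRegister_injective e')]
      exact ih (by simpa [e] using h)

theorem stepAux_popThen (k : Stk) (q : Option k.Sym → MStmt) (v : Register) (s : Store) :
    TM2.stepAux (popThen k q) v s.stk =
      TM2.stepAux (q (s.stk k).head?) (k.toRegister (s.stk k).head?) (s.pop k).stk := by
  rw [popThen, TM2.stepAux, stepAux_select _ _ _ _ _ (by simp), Store.stk_pop]

theorem stepAux_instr (i : Instr) (v : Register) (s : Store) :
    TM2.stepAux i.stmt v s.stk = (s.run i).cfg := by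
  rw [Instr.stmt, Store.run]
  cases i.action with
  | push p => exact stepAux_pushes p v s
  | pop k q =>
    simp only [stepAux_popThen]
    exact stepAux_pushes _ _ _

theorem step_cons (i : Instr) (w) (inp read cnt tmp stash acc out) :
    machine.step (Store.cfg ⟨i :: w, inp, read, cnt, tmp, stash, acc, out⟩) =
      some (Store.run ⟨w, inp, read, cnt, tmp, stash, acc, out⟩ i).cfg :=
  congrArg some ((stepAux_popThen .work _ none _).trans (stepAux_instr i _ _))

theorem step_nil (inp read cnt tmp stash acc out) :
    machine.step (Store.cfg ⟨[], inp, read, cnt, tmp, stash, acc, out⟩) =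
      some ⟨none, none, Store.stk ⟨[], inp, read, cnt, tmp, stash, acc, out⟩⟩ :=
  congrArg some (stepAux_popThen .work _ none _)


/-- Names are written in pieces of at most eight symbols. The uniform bound lets the running time
control the length of the output. -/
theorem Instr.action_acc_le (i : Instr) :
    (∀ p, i.action = .push p → p.acc.length ≤ 9) ∧
      ∀ k q, i.action = .pop k q → ∀ o, (q o).acc.length ≤ 9 := by
  refine ⟨fun p h => ?_, fun k q h o => ?_⟩
  · cases i <;> cases h <;> simp
  · cases i <;> cases h <;> rcases o with _ | o
    case walk.refl.none r =>
      have := r.is_lt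
      simp [FSym.num, strokes]
      omega
    case walk.refl.some => exact Nat.le_succ 8
    all_goals first
      | exact Nat.zero_le _
      | (cases o <;> first | exact Nat.zero_le _ | decide)

theorem Store.run_acc_le (s : Store) (i : Instr) : (s.run i).acc.length ≤ s.acc.length + 9 := by
  obtain ⟨h1, h2⟩ := i.action_acc_le
  rw [Store.run]
  cases h : i.action with
  | push p =>
    have := h1 p h
    simp [Store.push]
    omega
  | pop k q =>
    have := h2 k q h (s.stk k).head?
    have e : (s.pop k).acc.length ≤ s.acc.length := by cases k <;> simp [Store.pop]
    simp [Store.push]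
    omega

/-! ## Runs of the machine -/

/-- The machine gets from `s` to `s'` in at most `b` steps; the output grows accordingly. -/
def Reach (b : ℕ) (s s' : Store) : Prop :=
  ∃ n ≤ b, (flip bind machine.step)^[n] (some s.cfg) = some s'.cfg ∧
    s'.acc.length ≤ s.acc.length + 9 * n

theorem Reach.refl (s : Store) : Reach 0 s s := ⟨0, le_rfl, rfl, le_rfl⟩

theorem Reach.mono {b b' : ℕ} {s s' : Store} (h : Reach b s s') (hb : b ≤ b') : Reach b' s s' := by
  obtain ⟨n, hn, h⟩ := h
  exact ⟨n, hn.trans hb, h⟩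

theorem Reach.trans {b b' : ℕ} {s s' s'' : Store} (h : Reach b s s') (h' : Reach b' s' s'') :
    Reach (b + b') s s'' := by
  obtain ⟨n, hn, h1, h2⟩ := h
  obtain ⟨n', hn', h1', h2'⟩ := h'
  refine ⟨n' + n, by omega, ?_, by omega⟩
  rw [iterate_add_apply]
  exact (congrArg _ h1).trans h1'

theorem Reach.head {b : ℕ} {i : Instr} {w inp read cnt tmp stash acc out} {s' : Store}
    (h : Reach b (Store.run ⟨w, inp, read, cnt, tmp, stash, acc, out⟩ i) s') :
    Reach (b + 1) ⟨i :: w, inp, read, cnt, tmp, stash, acc, out⟩ s' := by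
  obtain ⟨n, hn, h1, h2⟩ := h
  refine ⟨n + 1, by omega, ?_, ?_⟩
  · rw [iterate_succ_apply]
    refine Eq.trans (congrArg _ ?_) h1
    exact step_cons i w inp read cnt tmp stash acc out
  · have : _ ≤ acc.length + 9 :=
      Store.run_acc_le ⟨w, inp, read, cnt, tmp, stash, acc, out⟩ i
    show _ ≤ acc.length + _
    omega

/-- Within `b` steps, the instructions `l` read `x`, write `s` and change the counter and the stash
from `k` to `k'`. -/
def Exec (b : ℕ) (l : List Instr) (x : List CSym) (k k' : List Bool × List Bool)
    (s : List FSym) : Prop :=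
  ∀ w rest read acc, Reach b ⟨l ++ w, x ++ rest, read, k.1, [], k.2, acc, []⟩
    ⟨w, rest, x.reverse ++ read, k'.1, [], k'.2, s.reverse ++ acc, []⟩

theorem Exec.mono {b b' l x k k' s} (h : Exec b l x k k' s) (hb : b ≤ b') : Exec b' l x k k' s :=
  fun w rest read acc => (h w rest read acc).mono hb

theorem Exec.nil (k) : Exec 0 [] [] k k [] := fun _ _ _ _ => .refl _

theorem Exec.append {b b' l l' x x' k k' k'' s s'} (h : Exec b l x k k' s)
    (h' : Exec b' l' x' k' k'' s') : Exec (b + b') (l ++ l') (x ++ x') k k'' (s ++ s') := by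
  intro w rest read acc
  have h1 := h (l' ++ w) (x' ++ rest) read acc
  have h2 := h' w rest (x.reverse ++ read) (s.reverse ++ acc)
  simpa using h1.trans h2

theorem Exec.cons {b b' i l x x' k k' k'' s s'} (h : Exec b [i] x k k' s)
    (h' : Exec b' l x' k' k'' s') : Exec (b + b') (i :: l) (x ++ x') k k'' (s ++ s') :=
  h.append h'

theorem Exec.sym (a : FSym) (k) : Exec 1 [.sym a] [] k k [a] :=
  fun _ _ _ _ => Reach.head (.refl _)

theorem Exec.sym_cons (a : FSym) {b l x k k' s} (h : Exec b l x k k' s) :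
    Exec (b + 1) (.sym a :: l) x k k' (a :: s) :=
  ((Exec.sym a k).append h).mono (by omega)

theorem Exec.syms (l : List FSym) (k) : Exec l.length (syms l) [] k k l := by
  induction l with
  | nil => exact .nil k
  | cons a l ih => exact .sym_cons a ih

theorem replicate_append_cons {α : Type} (n : ℕ) (a : α) (l : List α) :
    List.replicate n a ++ a :: l = List.replicate (n + 1) a ++ l := by
  rw [List.replicate_succ', List.append_assoc]
  rfl

theorem num_append_ones (a b : ℕ) (l : List FSym) (h : b = a + 8) :
    (FSym.num b).reverse ++ l = (FSym.num a).reverse ++ (List.replicate 8 .one ++ l) := by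
  subst h
  simp only [FSym.num, strokes, List.reverse_append, List.reverse_replicate, List.append_assoc]
  rw [← List.append_assoc (List.replicate a _), List.replicate_append_replicate]

theorem reach_back (tmp : List Bool) : ∀ w inp read cnt stash acc,
    Reach (tmp.length + 1) ⟨.back :: w, inp, read, cnt, tmp, stash, acc, []⟩
      ⟨w, inp, read, tmp.reverse ++ cnt, [], stash, acc, []⟩ := by
  induction tmp with
  | nil => exact fun _ _ _ _ _ _ => Reach.head (.refl _)
  | cons a tmp ih =>
    intro w inp read cnt stash acc
    rw [List.reverse_cons, List.append_assoc]
    exact Reach.head (ih w inp read (a :: cnt) stash acc)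

theorem reach_walk (r : Fin 8) (cnt : List Bool) : ∀ w inp read tmp stash acc,
    Reach (cnt.length + 1) ⟨.walk r :: w, inp, read, cnt, tmp, stash, acc, []⟩
      ⟨.back :: w, inp, read, [], cnt.reverse ++ tmp, stash,
        (FSym.num (8 * cnt.length + r)).reverse ++ acc, []⟩ := by
  induction cnt with
  | nil =>
    intro w inp read tmp stash acc
    simp only [List.length_nil, Nat.mul_zero, Nat.zero_add]
    exact Reach.head (.refl _)
  | cons a cnt ih =>
    intro w inp read tmp stash acc
    rw [num_append_ones (8 * cnt.length + r) _ _ (by simp; omega), List.reverse_cons,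
      List.append_assoc]
    exact Reach.head (ih w inp read (a :: tmp) stash (List.replicate 8 FSym.one ++ acc))

theorem Exec.walk (r : Fin 8) (k : List Bool × List Bool) :
    Exec (2 * k.1.length + 2) [.walk r] [] k k (FSym.num (8 * k.1.length + r)) := by
  intro w rest read acc
  have h1 := reach_walk r k.1 w rest read [] k.2 acc
  have h2 := reach_back (k.1.reverse ++ []) w rest read [] k.2
    ((FSym.num (8 * k.1.length + r)).reverse ++ acc)
  have h := (h1.trans h2).mono (b' := 2 * k.1.length + 2) (by simp; omega)
  simpa using h

theorem Exec.num (u : ℕ) (k) : Exec (u + 1) [.num] (CSym.num u) k k (FSym.num (node u)) := by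
  induction u with
  | zero => exact fun w rest read acc => Reach.head (.refl _)
  | succ u ih =>
    intro w rest read acc
    have e : (CSym.num (u + 1)).reverse ++ read = (CSym.num u).reverse ++ (.one :: read) := by
      simp only [CSym.num, strokes, List.reverse_append, List.reverse_replicate, List.append_assoc]
      rw [replicate_append_cons]
    rw [e, num_append_ones (node u) _ _ (by simp only [node]; omega)]
    exact Reach.head (ih w rest (.one :: read) (List.replicate 8 FSym.one ++ acc))

theorem Exec.mark (b : Bool) (k : List Bool × List Bool) :
    Exec 1 [.mark b] [] k (b :: k.1, k.2) [] :=
  fun _ _ _ _ => Reach.head (.refl _)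

theorem Exec.reset (M a : ℕ) (st : List Bool) :
    Exec (a + 1) [.reset] [] (List.replicate a false ++ List.replicate M true, st)
      (List.replicate M true, st) [] := by
  induction a with
  | zero =>
    cases M with
    | zero => exact fun _ _ _ _ => Reach.head (.refl _)
    | succ M => exact fun _ _ _ _ => Reach.head (.refl _)
  | succ a ih => exact fun w rest read acc => Reach.head (ih w rest read acc)

theorem Exec.clear (cnt : List Bool) (st : List Bool) :
    Exec (cnt.length + 1) [.clear] [] (cnt, st) ([], st) [] := by
  induction cnt with
  | nil => exact fun _ _ _ _ => Reach.head (.refl _)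
  | cons a cnt ih => exact fun w rest read acc => Reach.head (ih w rest read acc)

theorem Exec.unstash (st : List Bool) : ∀ cnt : List Bool,
    Exec (st.length + 1) [.unstash] [] (cnt, st) (st.reverse ++ cnt, []) [] := by
  induction st with
  | nil => exact fun _ _ _ _ _ => Reach.head (.refl _)
  | cons a st ih =>
    intro cnt w rest read acc
    rw [List.reverse_cons, List.append_assoc]
    exact Reach.head (ih (a :: cnt) w rest read acc)

/-! ## The program writes the formula -/

section

variable {c : ℕ}

def layerSyms (l : ℕ × PropFormula c) : List FSym :=
  .sum :: (FSym.num l.1 ++ .mul :: .prob :: l.2.encode)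

theorem weighted_encode (ls : List (ℕ × PropFormula c)) (t : ProbTerm c) :
    (weighted ls t).encode = ls.flatMap layerSyms ++ t.encode := by
  induction ls with
  | nil => rfl
  | cons l ls ih =>
    have : (weighted (l :: ls) t).encode =
      .sum :: (FSym.num l.1 ++ .mul :: (.prob :: l.2.encode ++ (weighted ls t).encode)) := rfl
    simp [this, ih, layerSyms]

theorem link_encode (X y : ℕ) :
    (link X y : PropFormula c).encode = .eq :: (FSym.num X ++ [.dummy]) ++ FSym.num y := by
  simp [link, PropFormula.encode, ValTerm.encode]

theorem Exec.link {b l x k k' y} (X : ℕ) (h : Exec b l x k k' (FSym.num y)) :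
    Exec (X + 3 + b) (linkProg X l) x k k' (link X y : PropFormula c).encode := by
  rw [link_encode]
  exact ((Exec.syms _ k).append h).mono (by simp [FSym.num, strokes])

theorem Exec.conj {b b' l l' x x' k k' k''} {δ δ' : PropFormula c} (h : Exec b l x k k' δ.encode)
    (h' : Exec b' l' x' k' k'' δ'.encode) :
    Exec (b + b' + 1) (.sym .conj :: (l ++ l')) (x ++ x') k k'' (δ.conj δ').encode :=
  .sym_cons _ (h.append h')

theorem Exec.layer {b b' l l' x k k'} {y : ℕ} {δ : PropFormula c} (h : Exec b l [] k k (FSym.num y))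
    (h' : Exec b' l' x k k' δ.encode) :
    Exec (b + b' + 3) (layerProg l l') x k k' (layerSyms (y, δ)) := by
  have := Exec.sym_cons .sum (h.append (Exec.sym_cons .mul (Exec.sym_cons .prob h')))
  exact this

/-- Unfold an instruction that reads one symbol and pushes instructions. -/
theorem Exec.read {b i a l x k k' s}
    (hi : ∀ w rest read acc, Store.run ⟨w, a :: rest, read, k.1, [], k.2, acc, []⟩ i =
      ⟨l ++ w, rest, a :: read, k.1, [], k.2, acc, []⟩)
    (h : Exec b l x k k' s) : Exec (b + 1) [i] (a :: x) k k' s := by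
  intro w rest read acc
  rw [List.reverse_cons, List.append_assoc]
  refine Reach.head ?_
  exact (hi w (x ++ rest) read acc).symm ▸ h w rest (a :: read) acc

theorem Exec.walk_node {B : ℕ} {k : List Bool × List Bool} (hB : k.1.length ≤ B) :
    Exec (2 * B + 2) [.walk 7] [] k k (FSym.num (node k.1.length)) :=
  (Exec.walk 7 k).mono (by omega)

theorem Exec.inputs {B : ℕ} (m : ℕ) : ∀ k : List Bool × List Bool, k.1.length + m ≤ B →
    Exec ((4 * B + 20) * (m + 1)) [.inputs] (CSym.num m) k (List.replicate m true ++ k.1, k.2)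
      ((inputLayers (c := c) k.1.length m).flatMap layerSyms) := by
  induction m with
  | zero =>
    exact fun k _ => Exec.mono (b := 1) (fun w rest read acc => Reach.head (.refl _)) (by omega)
  | succ m ih =>
    intro k hk
    have hw := Exec.walk_node (B := B) (k := k) (by omega)
    have h1 := (hw.layer (hw.link (c := c) 0)).append
      ((Exec.mark true k).append (ih (true :: k.1, k.2) (by simp; omega)))
    have h2 := Exec.read (a := .one) (i := .inputs) (fun _ _ _ _ => by rfl) h1
    rw [← replicate_append_cons]
    exact Exec.mono h2 (by ring_nf; omega)

theorem Exec.skip (m : ℕ) (k) : Exec (m + 1) [.skip] (CSym.num m) k k [] := by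
  induction m with
  | zero => exact fun w rest read acc => Reach.head (.refl _)
  | succ m ih => exact .read (l := [.skip]) (fun _ _ _ _ => rfl) ih

end

/-! ### Writing gates and outputs. -/

section

variable {c : ℕ}

theorem gateList_le {n m : ℕ} (G : GateList n m) : n ≤ m := by
  induction G with
  | nil => exact le_rfl
  | cons g rest ih => omega

theorem gateList_le_length {n m : ℕ} (G : GateList n m) : m ≤ n + G.encode.length := by
  induction G with
  | nil => simp
  | cons g rest ih =>
    have : 1 ≤ g.encode.length := by cases g <;> simp [Gate.encode]
    simp only [GateList.encode, List.length_append]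
    omega

theorem num_length (u : ℕ) : (CSym.num u).length = u + 1 := by
  simp [CSym.num, strokes]

theorem Exec.binary {B u w : ℕ} (X : ℕ) {k : List Bool × List Bool} (hB : k.1.length ≤ B) :
    Exec (4 * B + 21 + X + u + w) (binaryProg X) (CSym.num u ++ CSym.num w) k k
      (layerSyms (c := c) (node k.1.length, .conj (SuccReduction.link X (node k.1.length))
        (.conj (SuccReduction.link 0 (node u)) (SuccReduction.link 1 (node w))))) := by
  have hw := Exec.walk_node hB
  exact (hw.layer ((hw.link X).conj (((Exec.num u k).link 0).conj ((Exec.num w k).link 1)))).mono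
    (by omega)

/-- The counter always equals the number of existing nodes, so `walk 7` names the gate being read.
The time is charged to the length of its encoding. -/
theorem Exec.gates {B n m : ℕ} (G : GateList n m) (hm : m ≤ B) : ∀ k : List Bool × List Bool,
    k.1.length = n → Exec ((4 * B + 30) * G.encode.length) [.gates] G.encode k
      (List.replicate (m - n) false ++ k.1, k.2) ((gateLayers (c := c) G).flatMap layerSyms) := by
  induction G with
  | nil n =>
    intro k hk
    rw [Nat.sub_self]
    exact Exec.mono (b := 1) (fun w rest read acc => Reach.head (.refl _))
      (by simp [GateList.encode])
  | @cons n m g rest ih =>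
    intro k hk
    have hle := gateList_le rest
    have hrest := (Exec.mark false k).append (ih hm (false :: k.1, k.2) (by simp [hk]))
    have hB : k.1.length ≤ B := by omega
    have e : List.replicate (m - n) false ++ k.1 =
        List.replicate (m - (n + 1)) false ++ false :: k.1 := by
      rw [replicate_append_cons]
      congr 2
      omega
    rw [e]
    subst hk
    cases g with
    | neg u =>
      have hw := Exec.walk_node hB
      have h := (hw.layer ((hw.link (c := c) 2).conj ((Exec.num u k).link 0))).append hrest
      refine (Exec.read (a := .neg) (i := .gates) (fun _ _ _ _ => by rfl) h).mono ?_
      simp only [GateList.encode, Gate.encode, List.length_append, List.length_cons, num_length]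
      ring_nf
      omega
    | conj u w =>
      have h := (Exec.binary (c := c) (u := u) (w := w) 3 hB).append hrest
      have h' := Exec.read (a := .conj) (i := .gates) (fun _ _ _ _ => by rfl) h
      refine Exec.mono (b := _) h' ?_
      simp only [GateList.encode, Gate.encode, List.length_append, List.length_cons, num_length]
      ring_nf
      omega
    | disj u w =>
      have h := (Exec.binary (c := c) (u := u) (w := w) 4 hB).append hrest
      have h' := Exec.read (a := .disj) (i := .gates) (fun _ _ _ _ => by rfl) h
      refine Exec.mono (b := _) h' ?_
      simp only [GateList.encode, Gate.encode, List.length_append, List.length_cons, num_length]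
      ring_nf
      omega

/-- Unfold an instruction that inspects the next symbol and pushes instructions. -/
theorem Exec.peek {b i a l x k k' s}
    (hi : ∀ w rest read acc, Store.run ⟨w, a :: rest, read, k.1, [], k.2, acc, []⟩ i =
      ⟨l ++ w, a :: rest, read, k.1, [], k.2, acc, []⟩)
    (h : Exec b l (a :: x) k k' s) : Exec (b + 1) [i] (a :: x) k k' s := by
  intro w rest read acc
  refine Reach.head ?_
  exact (hi w (x ++ rest) read acc).symm ▸ h w rest read acc

theorem Exec.outs {B M : ℕ} (i : Fin 7) (us : List ℕ) : ∀ (t : ℕ) (k : List Bool × List Bool),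
    k.1.length = M + t → M + t + us.length ≤ B →
    Exec ((4 * B + 30) * ((us.map CSym.num).flatten ++ [CSym.done]).length) [.outs i]
      ((us.map CSym.num).flatten ++ [.done]) k (List.replicate us.length false ++ k.1, k.2)
      ((outLayers (c := c) M i t us).flatMap layerSyms) := by
  induction us with
  | nil =>
    intro t k hk hB
    exact Exec.mono (b := 1) (fun w rest read acc => Reach.head (.refl _)) (by simp)
  | cons u us ih =>
    intro t k hk hB
    rw [List.length_cons] at hB
    have hw : Exec (2 * B + 2) [.walk i.castSucc] [] k k (FSym.num (outVar M i t)) := by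
      have := Exec.walk i.castSucc k
      rw [hk] at this
      exact this.mono (by omega)
    have h := (hw.layer ((hw.link (c := c) 0).conj ((Exec.num u k).link 0))).append
      ((Exec.mark false k).append (ih (t + 1) (false :: k.1, k.2) (by simp; omega) (by omega)))
    have h' : Exec (2 * B + 2 + (0 + 3 + (2 * B + 2) + (0 + 3 + (u + 1)) + 1) + 3 +
        (1 + (4 * B + 30) * ((us.map CSym.num).flatten ++ [CSym.done]).length) + 1) [.outs i]
        (CSym.num u ++ ((us.map CSym.num).flatten ++ [.done])) k
        (List.replicate (u :: us).length false ++ k.1, k.2)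
        ((outLayers (c := c) M i t (u :: us)).flatMap layerSyms) := by
      rw [List.length_cons, ← replicate_append_cons]
      -- The number of the output node begins with a stroke or with the separator; `outs` reacts to
      -- both in the same way.
      cases u with
      | zero => exact Exec.peek (fun _ _ _ _ => by rfl) h
      | succ u => exact Exec.peek (fun _ _ _ _ => by rfl) h
    rw [List.map_cons, List.flatten_cons, List.append_assoc]
    refine h'.mono ?_
    simp only [List.length_append, num_length]
    ring_nf
    omega

end

/-! ### Writing events and polynomials. -/

section

variable {d : ℕ}

theorem verum_encode : (PropFormula.neg (falsum (d := d))).encode = verumSyms := by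
  simp [verumSyms, falsum, PropFormula.encode, ValTerm.encode]

/-- The output marks move to the stash one by one while their links are written. Once only input
marks remain, `unstash` restores the counter. -/
theorem Exec.event {B M : ℕ} (i : Fin 7) (N : ℕ) : ∀ st : List Bool, M + N ≤ B →
    Exec (N * (4 * B + 10) + st.length + 15) [.event i] []
      (List.replicate N false ++ List.replicate M true, st)
      (st.reverse ++ (List.replicate N false ++ List.replicate M true), [])
      (SuccReduction.event (d := d) M i N).encode := by
  induction N with
  | zero =>
    intro st hB
    have h := (Exec.syms verumSyms (List.replicate M true, st)).append
      (Exec.unstash st (List.replicate M true))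
    have h' : Exec (verumSyms.length + (st.length + 1) + 1) [.event i] [] (List.replicate M true, st)
        (st.reverse ++ List.replicate M true, []) (verumSyms ++ []) := by
      intro w rest read acc
      refine Reach.head ?_
      cases M with
      | zero => exact h w rest read acc
      | succ M => exact h w rest read acc
    rw [List.append_nil, ← verum_encode (d := d)] at h'
    refine h'.mono ?_
    simp [falsum, PropFormula.encode, ValTerm.encode, FSym.num, strokes]
    omega
  | succ N ih =>
    intro st hB
    set k : List Bool × List Bool := (List.replicate N false ++ List.replicate M true, false :: st)
      with hk
    have hl : k.1.length = M + N := by simp [hk, Nat.add_comm]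
    have hw : ∀ r, Exec (2 * B + 2) [.walk r] [] k k (FSym.num (8 * (M + N) + r)) := fun r => by
      have := Exec.walk r k
      rw [hl] at this
      exact this.mono (by omega)
    have h := Exec.sym_cons .conj (Exec.sym_cons .eq ((hw 7).cons (Exec.sym_cons .dummy
      ((hw i.castSucc).cons (ih (false :: st) (by omega))))))
    have e : (SuccReduction.event (d := d) M i (N + 1)).encode = .conj :: .eq ::
        (FSym.num (8 * (M + N) + (7 : Fin 8)) ++ .dummy :: (FSym.num (8 * (M + N) + i.castSucc) ++
          (SuccReduction.event (d := d) M i N).encode)) := by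
      simp [SuccReduction.event, PropFormula.encode, link_encode, outVar]
    rw [e]
    have h' := fun w rest read acc => Reach.head (i := .event i)
      (cnt := List.replicate (N + 1) false ++ List.replicate M true) (stash := st) (tmp := [])
      (out := []) (h w rest read acc)
    rw [List.reverse_cons, List.append_assoc] at h'
    refine Exec.mono (b := _) h' ?_
    rw [List.length_cons]
    ring_nf
    omega

def NatPoly.size : NatPoly → ℕ
  | .one => 1
  | .var _ => 1
  | .add p q => p.size + q.size + 1
  | .mul p q => p.size + q.size + 1

/-- Counter and stash return to their initial state, so subterms can be written one after the other.
A leaf costs at most `N ≤ B` links with names of length linear in `B`, hence the square. -/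
theorem Exec.poly {B M N : ℕ} (hB : M + N ≤ B) (p : NatPoly) :
    Exec (p.size * (40 * (B + 1) ^ 2)) p.prog []
      (List.replicate N false ++ List.replicate M true, [])
      (List.replicate N false ++ List.replicate M true, []) (p.toTerm (d := d) M N).encode := by
  induction p with
  | one =>
    rw [NatPoly.toTerm, ProbTerm.encode, verum_encode]
    refine (Exec.syms _ _).mono ?_
    have : (.prob :: verumSyms : List FSym).length = 12 := rfl
    rw [this, NatPoly.size]
    nlinarith [Nat.zero_le B]
  | var i =>
    have h := (Exec.syms (.cond :: .eq :: (FSym.num 5 ++ .const :: FSym.num 0)) _).append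
      (Exec.event (d := d) i N [] hB)
    have e : ((NatPoly.var i).toTerm (d := d) M N).encode =
        .cond :: .eq :: (FSym.num 5 ++ .const :: FSym.num 0) ++
          (SuccReduction.event (d := d) M i N).encode := by
      simp [NatPoly.toTerm, ProbTerm.encode, PropFormula.encode, ValTerm.encode]
    rw [e]
    refine Exec.mono h ?_
    have : (.cond :: .eq :: (FSym.num 5 ++ .const :: FSym.num 0) : List FSym).length = 10 := rfl
    rw [this, NatPoly.size, List.length_nil]
    have : N * (4 * B + 10) ≤ B * (4 * B + 10) := Nat.mul_le_mul_right _ (by omega)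
    nlinarith
  | add p q hp hq =>
    refine (Exec.sym_cons .add (hp.append hq)).mono ?_
    rw [NatPoly.size]
    nlinarith [Nat.zero_le B]
  | mul p q hp hq =>
    refine (Exec.sym_cons .mul (hp.append hq)).mono ?_
    rw [NatPoly.size]
    nlinarith [Nat.zero_le B]

end

/-! ### Writing the seven circuits. -/

section

variable {c : ℕ}

theorem Exec.circuit {B M N : ℕ} (i : Fin 7) (C : Circuit M N) (hB : M + N ≤ B) (hC : C.nodes ≤ B)
    (a : ℕ) (ha : a ≤ B) :
    Exec (2 * (4 * B + 30) * C.encode.length) (circuitProg i) C.encode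
      (List.replicate a false ++ List.replicate M true, [])
      (List.replicate N false ++ List.replicate M true, [])
      ((circuitLayers (c := c) i C).flatMap layerSyms) := by
  have h1 := Exec.reset M a []
  have h2 := Exec.gates (c := c) C.gates hC (List.replicate M true, []) (by simp)
  have h3 := Exec.reset M (C.nodes - M) []
  have h4 := Exec.outs (c := c) (B := B) (M := M) i (List.ofFn fun k => (C.out k : ℕ)) 0
    (List.replicate M true, []) (by simp) (by simpa using hB)
  have h := h1.append (h2.append (h3.append h4))
  have e : ((List.ofFn fun k => (C.out k : ℕ)).map CSym.num) =
      List.ofFn fun k => CSym.num (C.out k) := by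
    rw [List.map_ofFn]
    rfl
  rw [e, List.length_ofFn] at h
  rw [circuitLayers, List.flatMap_append]
  refine Exec.mono (b := _) h ?_
  have hl : 1 ≤ C.encode.length := by simp [Circuit.encode]; omega
  have hl' : C.encode.length = C.gates.encode.length +
      ((List.ofFn fun k => CSym.num (C.out k)).flatten ++ [CSym.done]).length := by
    rw [Circuit.encode, List.length_append]
  have : a + 1 + (C.nodes - M + 1) ≤ (4 * B + 30) * C.encode.length := by
    calc a + 1 + (C.nodes - M + 1) ≤ (4 * B + 30) * 1 := by omega
      _ ≤ _ := Nat.mul_le_mul_left _ hl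
  rw [Nat.mul_assoc, Nat.two_mul]
  refine le_trans ?_ (Nat.add_le_add_right this _)
  rw [hl', Nat.mul_add]
  omega

/-- Every circuit tolerates leftover marks and leaves `N` of its own; `a` and `a'` keep track of
this. -/
theorem Exec.circuits {B : ℕ} (I : SuccInstance) (hB : I.M + I.N ≤ B) (hC : ∀ i, (I.C i).nodes ≤ B)
    (is : List (Fin 7)) : ∀ a ≤ B, ∃ a' ≤ B, (is = [] → a' = a) ∧ (is ≠ [] → a' = I.N) ∧
    Exec (2 * (4 * B + 30) * (is.map fun i => (I.C i).encode).flatten.length) (is.flatMap circuitProg)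
      (is.map fun i => (I.C i).encode).flatten
      (List.replicate a false ++ List.replicate I.M true, [])
      (List.replicate a' false ++ List.replicate I.M true, [])
      ((circuitsLayers (c := c) I is).flatMap layerSyms) := by
  induction is with
  | nil => exact fun a ha => ⟨a, ha, fun _ => rfl, fun h => absurd rfl h, .nil _⟩
  | cons i is ih =>
    intro a ha
    obtain ⟨a', ha', he, he', h⟩ := ih I.N (by omega)
    refine ⟨a', ha', fun h => absurd h (List.cons_ne_nil _ _), fun _ => ?_, ?_⟩
    · exact (em (is = [])).elim he he'
    · have := (Exec.circuit (c := c) i (I.C i) hB (hC i) a ha).append h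
      rw [← Nat.mul_add, ← List.length_append] at this
      simpa [circuitsLayers] using this

end

/-! ### The complete run and its time bound. -/

section

variable {d : ℕ}

theorem exec_sideProg (left : Bool) (I : SuccInstance) :
    Exec ((100 + 40 * (side left).size) * (I.encode.length + 1) ^ 2) (sideProg left) I.encode ([], [])
      (List.replicate I.N false ++ List.replicate I.M true, []) (sideTerm (d := d) I left).encode := by
  set B := I.encode.length with hB
  have hlen : B = (I.M + 1) + ((I.N + 1) +
      ((List.finRange 7).map fun i => (I.C i).encode).flatten.length) := by
    rw [hB, SuccInstance.encode, List.length_append, List.length_append, num_length, num_length,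
      List.ofFn_eq_map]
  have hC : ∀ i, (I.C i).nodes ≤ B := by
    intro i
    have h1 : (I.C i).encode.length ≤
        ((List.finRange 7).map fun i => (I.C i).encode).flatten.length :=
      (List.sublist_flatten_of_mem (List.mem_map_of_mem (f := fun i => (I.C i).encode)
        (List.mem_finRange i))).length_le
    have h2 := gateList_le_length (I.C i).gates
    have h3 : (I.C i).gates.encode.length ≤ (I.C i).encode.length := by simp [Circuit.encode]
    omega
  have h1 := Exec.inputs (c := d + 2) (B := B) I.M ([], []) (by simp; omega)
  have h2 := Exec.skip I.N (List.replicate I.M true ++ [], [])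
  obtain ⟨a', -, -, ha', h3⟩ := Exec.circuits (c := d + 2) (B := B) I (by omega) hC
    (List.finRange 7) 0 (Nat.zero_le _)
  obtain rfl := ha' (by simp)
  have h4 := Exec.poly (d := d) (B := B) (M := I.M) (N := I.N) (by omega) (side left)
  rw [List.append_nil] at h1 h2
  have h := (h1.append h2).append (h3.append h4)
  simp only [List.append_nil] at h
  rw [sideTerm, weighted_encode, layers, List.flatMap_append, List.append_assoc]
  have e : I.encode = CSym.num I.M ++ CSym.num I.N ++
      ((List.finRange 7).map fun i => (I.C i).encode).flatten := by
    rw [SuccInstance.encode, List.ofFn_eq_map, List.append_assoc]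
  rw [e]
  refine Exec.mono h ?_
  have e1 : (4 * B + 20) * (I.M + 1) ≤ (4 * B + 20) * B := Nat.mul_le_mul_left _ (by omega)
  have e2 : 2 * (4 * B + 30) * ((List.finRange 7).map fun i => (I.C i).encode).flatten.length ≤
      2 * (4 * B + 30) * B := Nat.mul_le_mul_left _ (by omega)
  nlinarith

/-- Only the values 0 and 1 are written, so the same program serves every number of values. -/
theorem tableProduct_encode :
    (tableProduct (d := d)).encode = (tableProduct (d := 0)).encode := by
  simp [tableProduct, tableRow, code, ProbTerm.encode, PropFormula.encode, ValTerm.encode]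

theorem formula_encode (I : SuccInstance) : (formula d I).encode =
    constantSyms ++ ((sideTerm (d := d) I true).encode ++ (sideTerm (d := d) I false).encode) := by
  have h : (falsum (d := d)).encode = (falsum (d := 0)).encode := by
    simp [falsum, PropFormula.encode, ValTerm.encode]
  rw [formula, ProbFormula.encode, ProbFormula.encode, ProbFormula.encode, ProbFormula.encode,
    tableProduct_encode, ProbTerm.encode.eq_1, h]
  simp [constantSyms]

theorem reach_rewind (read : List CSym) : ∀ w inp cnt tmp stash acc,
    Reach (read.length + 1) ⟨.rewind :: w, inp, read, cnt, tmp, stash, acc, []⟩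
      ⟨w, read.reverse ++ inp, [], cnt, tmp, stash, acc, []⟩ := by
  induction read with
  | nil => exact fun _ _ _ _ _ _ => Reach.head (.refl _)
  | cons a read ih =>
    intro w inp cnt tmp stash acc
    rw [List.reverse_cons, List.append_assoc]
    exact Reach.head (ih w (a :: inp) cnt tmp stash acc)

theorem reach_drain (inp : List CSym) : ∀ w read cnt tmp stash acc,
    Reach (inp.length + 1) ⟨.drain :: w, inp, read, cnt, tmp, stash, acc, []⟩
      ⟨w, [], read, cnt, tmp, stash, acc, []⟩ := by
  induction inp with
  | nil => exact fun _ _ _ _ _ _ => Reach.head (.refl _)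
  | cons a inp ih =>
    intro w read cnt tmp stash acc
    exact Reach.head (ih w read cnt tmp stash acc)

theorem reach_flip (acc : List FSym) : ∀ w inp read cnt tmp stash out,
    Reach (acc.length + 1) ⟨.flip :: w, inp, read, cnt, tmp, stash, acc, out⟩
      ⟨w, inp, read, cnt, tmp, stash, [], acc.reverse ++ out⟩ := by
  induction acc with
  | nil => exact fun _ _ _ _ _ _ _ => Reach.head (.refl _)
  | cons a acc ih =>
    intro w inp read cnt tmp stash out
    rw [List.reverse_cons, List.append_assoc]
    exact Reach.head (ih w inp read cnt tmp stash (a :: out))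

theorem reach_side (left : Bool) (I : SuccInstance) (w acc) :
    Reach ((110 + 40 * (side left).size) * (I.encode.length + 1) ^ 2)
      ⟨sideProg left ++ .clear :: .rewind :: w, I.encode, [], [], [], [], acc, []⟩
      ⟨w, I.encode, [], [], [], [], (sideTerm (d := d) I left).encode.reverse ++ acc, []⟩ := by
  have h := ((exec_sideProg (d := d) left I).append
    (Exec.clear (List.replicate I.N false ++ List.replicate I.M true) [])) (.rewind :: w) [] [] acc
  have h' := h.trans (reach_rewind _ _ _ _ _ _ _)
  simp only [List.append_nil, List.reverse_reverse, List.append_assoc, List.singleton_append,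
    List.length_append, List.length_reverse, List.length_replicate] at h'
  refine h'.mono ?_
  have : I.M + I.N ≤ I.encode.length := by
    rw [SuccInstance.encode, List.length_append, List.length_append, num_length, num_length]
    omega
  nlinarith

/-- The constant in the time bound. -/
def timeFactor : ℕ :=
  constantSyms.length + (110 + 40 * (side true).size) + (110 + 40 * (side false).size) + 1

theorem reach_program (I : SuccInstance) :
    Reach (10 * timeFactor * (I.encode.length + 1) ^ 2 + 1)
      ⟨program, I.encode, [], [], [], [], [], []⟩
      ⟨[], [], [], [], [], [], [], (formula d I).encode⟩ := by
  set L := I.encode.length with hL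
  have h1 := Exec.syms constantSyms ([], []) (sideProg true ++ .clear :: .rewind ::
    (sideProg false ++ .clear :: .rewind :: [.drain, .flip])) I.encode [] []
  have h2 := reach_side (d := d) true I (sideProg false ++ .clear :: .rewind :: [.drain, .flip])
    (constantSyms.reverse ++ [])
  have h3 := reach_side (d := d) false I [.drain, .flip]
    ((sideTerm (d := d) I true).encode.reverse ++ (constantSyms.reverse ++ []))
  have h4 := reach_drain I.encode [.flip] [] [] [] []
    ((sideTerm (d := d) I false).encode.reverse ++
      ((sideTerm (d := d) I true).encode.reverse ++ (constantSyms.reverse ++ [])))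
  have h := ((h1.trans h2).trans h3).trans h4
  have e : (sideTerm (d := d) I false).encode.reverse ++
      ((sideTerm (d := d) I true).encode.reverse ++ (constantSyms.reverse ++ [])) =
      (formula d I).encode.reverse := by
    rw [formula_encode]
    simp
  rw [e] at h
  have h' := h.mono (b' := timeFactor * (L + 1) ^ 2) <| by
    rw [timeFactor, ← hL]
    nlinarith [Nat.zero_le (constantSyms.length * (L * L)), Nat.zero_le (constantSyms.length * L)]
  -- At most nine symbols are written in each step, so the time spent so far bounds the cost of the
  -- final `flip`.
  have hacc : (formula d I).encode.length ≤ 9 * (timeFactor * (L + 1) ^ 2) := by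
    obtain ⟨n, hn, -, ha⟩ := h'
    simp only [List.length_reverse, List.length_nil, Nat.zero_add] at ha
    exact ha.trans (Nat.mul_le_mul_left _ hn)
  have h5 := reach_flip (formula d I).encode.reverse [] [] [] [] [] [] []
  have h6 := (h'.trans h5).mono (b' := 10 * timeFactor * (L + 1) ^ 2 + 1) (by
    rw [List.length_reverse, Nat.mul_assoc]
    omega)
  rw [List.reverse_reverse, List.append_nil] at h6
  exact h6

/-! ### Initial and final configurations. -/

theorem initList_eq (s : List CSym) : initList machine s =
    ⟨some .start, none, Store.stk ⟨[], s, [], [], [], [], [], []⟩⟩ := by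
  refine congrArg (TM2.Cfg.mk (some Label.start) none) (funext fun k => ?_)
  cases k <;> rfl

theorem haltList_eq (s : List FSym) : haltList machine s =
    ⟨none, none, Store.stk ⟨[], [], [], [], [], [], [], s⟩⟩ := by
  refine congrArg (TM2.Cfg.mk none none) (funext fun k => ?_)
  cases k <;> rfl

theorem machine_step (l : Label) (v : Register) (S : ∀ k : Stk, List k.Sym) :
    machine.step (TM2.Cfg.mk (some l) v S) = some (TM2.stepAux (machineStmt l) v S) := rfl

theorem step_start (s : List CSym) : machine.step (initList machine s) =
    some (Store.cfg ⟨program, s, [], [], [], [], [], []⟩) := by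
  rw [initList_eq]
  have h := stepAux_pushes { work := program } none ⟨[], s, [], [], [], [], [], []⟩
  have e : Store.push ⟨[], s, [], [], [], [], [], []⟩ { work := program } =
      ⟨program, s, [], [], [], [], [], []⟩ :=
    congrArg (fun w => Store.mk w s [] [] [] [] [] []) (List.append_nil program)
  have h0 : machineStmt .start = Pushes.stmt { work := program } := by rw [machineStmt]
  rw [e, ← h0] at h
  exact (machine_step _ _ _).trans (congrArg some h)

theorem machine_outputs (I : SuccInstance) :
    ∃ n ≤ 10 * timeFactor * (I.encode.length + 1) ^ 2 + 3,
      (flip bind machine.step)^[n] (some (initList machine I.encode)) =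
        some (haltList machine (formula d I).encode) := by
  obtain ⟨n, hn, h, -⟩ := reach_program (d := d) I
  -- One step to load the program and one to halt on the empty instruction stack.
  refine ⟨n + 1 + 1, by omega, ?_⟩
  rw [iterate_succ_apply', iterate_succ_apply, haltList_eq]
  have e : flip bind machine.step (some (initList machine I.encode)) =
      some (Store.cfg ⟨program, I.encode, [], [], [], [], [], []⟩) := step_start I.encode
  exact (congrArg (flip bind machine.step) ((congrArg _ e).trans h)).trans
    (step_nil [] [] [] [] [] [] (formula d I).encode)

theorem eval_time (a x : ℕ) :
    (Polynomial.C a * (Polynomial.X + 1) ^ 2 + 3 : Polynomial ℕ).eval x = a * (x + 1) ^ 2 + 3 := by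
  simp

noncomputable def computableInPolyTime (d : ℕ) :
    TM2ComputableInPolyTime SuccInstance.encode (ProbFormula.encode (c := d + 2)) (formula d) where
  tm := machine
  inputAlphabet := Equiv.refl CSym
  outputAlphabet := Equiv.refl FSym
  time := Polynomial.C (10 * timeFactor) * (Polynomial.X + 1) ^ 2 + 3
  outputsFun I := by
    have h := (machine_outputs (d := d) I).choose_spec
    refine ⟨⟨(machine_outputs (d := d) I).choose, ?_⟩, ?_⟩
    -- Abstracting over the strings removes the translation of alphabets, which is the identity.
    · have key : ∀ (s : List (machine.Γ machine.k₀)) (t : List (machine.Γ machine.k₁)),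
          s = I.encode → t = (formula d I).encode →
          (flip bind machine.step)^[(machine_outputs (d := d) I).choose]
            (some (initList machine s)) = some (haltList machine t) := by
        rintro _ _ rfl rfl
        exact h.2
      exact key _ _ (List.map_id _) (List.map_id _)
    · rw [eval_time]
      exact h.1

end

end SuccReduction

theorem proposition3 (c : ℕ) (hc : 2 ≤ c) :
    PolyTimeReducible SuccInstance.encoding (ProbFormula.encoding c)
      (SuccETR (1 / 8) (-(1 / 8)) (1 / 8)) (SatProb c) := by
  obtain ⟨d, rfl⟩ := Nat.exists_eq_add_of_le' hc
  exact ⟨SuccReduction.formula d, ⟨SuccReduction.computableInPolyTime d⟩,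
    SuccReduction.mem_succETR_iff d⟩
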